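/- Fix constants $\kappa\in(0,1/2)$, $q,\beta\in(0,1)$ and $\mu_1,\mu_2,\gamma_1,\gamma_2\in\mathbb R$. For each $n$ large enough that all the probabilities below lie in $[0,1]$, let $c\in\{1,2\}^n$ have independent entries with $\mathbb P(c_i=1)=\kappa$; given $c$, let $A$ be the symmetric $0/1$ adjacency matrix with zero diagonal whose entries $A_{ij}$, $i<j$, are independent with $\mathbb P(A_{ij}=1\mid c)=B_{c_ic_j}$, where $B_{gg}=q+\mu_g/\sqrt n$ and $B_{12}=B_{21}=q$. Let $Y,Y^*$ be symmetric $0/1$ matrices with zero diagonal which, given $(c,A)$, are independent and identically distributed, with independent entries over $i<j$ such that $Y_{ij}=0$ if $A_{ij}=0$ and $\mathbb P(Y_{ij}=0\mid A_{ij}=1)=\beta_{c_ic_j}$, where $\beta_{gg}=\beta-\gamma_g/\sqrt n$ and $\beta_{12}=\beta_{21}=\beta$. Let $n_g=|\{i:c_i=g\}|$, $N_g=\binom{n_g}{2}$, $N_{\mathrm b}=n_1n_2$, and for $g=1,2$ $$\hat u_{1,g}=\frac1{N_g}\sum_{i<j:\,c_i=c_j=g}Y_{ij},\quad \hat u_{2,g}=\frac1{2N_g}\sum_{i<j:\,c_i=c_j=g}|Y_{ij}-Y^*_{ij}|,\quad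 \hat u_{1,\mathrm b}=\frac1{N_{\mathrm b}}\sum_{i<j:\,c_i\ne c_j}Y_{ij},\quad \hat u_{2,\mathrm b}=\frac1{2N_{\mathrm b}}\sum_{i<j:\,c_i\neq c_j}|Y_{ij}-Y^*_{ij}|,$$ and $\hat\beta_{\mathrm x}=\hat u_{2,\mathrm x}/\hat u_{1,\mathrm x}$ for $\mathrm x\in\{1,2,\mathrm b\}$, $\hat\gamma_g=\sqrt n(\hat\beta_{\mathrm b}-\hat\beta_g)$ (quotients with zero denominator are set to $0$). Put $q^*=(1-\beta)q$ and $$\Sigma_u=\begin{pmatrix}q^*(1-q^*)&(\tfrac12-q^*)\beta q^*\\(\tfrac12-q^*)\beta q^*&(\tfrac12-\beta q^*)\beta q^*\end{pmatrix},\qquad D=\begin{pmatrix}0&0&0&0&-\frac{\beta}{q^*}&\frac1{q^*}\\ \frac{\beta}{q^*}&-\frac1{q^*}&0&0&-\frac{\beta}{q^*}&\frac1{q^*}\\0&0&\frac{\beta}{q^*}&-\frac1{q^*}&-\frac{\beta}{q^*}&\frac1{q^*}\end{pmatrix},$$ $$\Sigma_\beta=D\,\operatorname{diag}\Bigl(\tfrac{2}{\kappa^2}\Sigma_u,\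 \tfrac{2}{(1-\kappa)^2}\Sigma_u,\ \tfrac1{\kappa(1-\kappa)}\Sigma_u\Bigr)D^{\mathsf T}.$$ ($D$ is the Jacobian of $(u,v,w,x,y,z)\mapsto(\frac zy,\frac zy-\frac vu,\frac zy-\frac xw)$ at $(q^*,\beta q^*,q^*,\beta q^*,q^*,\beta q^*)$.) Then the $3\times3$ matrix $\Sigma_\beta$ is positive definite, and as $n\to\infty$ $$\begin{pmatrix}n(\hat\beta_{\mathrm b}-\beta)\\ \sqrt n(\hat\gamma_1-\gamma_1)\\ \sqrt n(\hat\gamma_2-\gamma_2)\end{pmatrix}\ \stackrel{d}{\longrightarrow}\ \mathcal N(0,\Sigma_\beta).$$ Moreover $\mathbb P(Y\ne Y^*)\to1$, and the same convergence holds for the conditional law of the vector given the event $Y\neq Y^*$. -/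

import Mathlib

open MeasureTheory ProbabilityTheory Filter Topology
open scoped BoundedContinuousFunction

namespace NoisySBM

/-- Group labels of `n` nodes: `0` is the minority group (group 1), `1` the majority (group 2). -/
abbrev Labels (n : ℕ) : Type := Fin n → Fin 2

/-- Binary `n × n` matrices. -/
abbrev BinMat (n : ℕ) : Type := Fin n → Fin n → Bool

/-- Adjacency matrices of undirected networks without self-loops. -/
def IsAdjacency {n : ℕ} (a : BinMat n) : Prop :=
  (∀ i, a i i = false) ∧ ∀ i j, a i j = a j i

/-- The probability that a Bernoulli(`p`) variable equals `b`. -/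
def bernWeight (p : ℝ) (b : Bool) : ℝ := if b then p else 1 - p

/-- The unordered node pairs, represented by `i < j`. -/
def nodePairs (n : ℕ) : Finset (Fin n × Fin n) :=
  Finset.univ.filter fun p => p.1 < p.2

open Classical in
/-- Joint probability mass function of the labels `c`, the construct network `A` and the two
replicates `Y`, `Y*`: labels are i.i.d. with `P(c i = group 1) = κ`; given the labels, the edges
`A i j`, `i < j`, are independent Bernoulli(`B (c i) (c j)`); given `(c, A)`, all the `Y i j` and
`Y* i j`, `i < j`, are independent, each is `0` with probability `E (c i) (c j)` if `A i j = 1`,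
and is `0` if `A i j = 0` (only type II errors occur). -/
noncomputable def massFun (n : ℕ) (κ : ℝ) (B E : Matrix (Fin 2) (Fin 2) ℝ)
    (x : Labels n × BinMat n × BinMat n × BinMat n) : ℝ :=
  let c := x.1
  let a := x.2.1
  let y := x.2.2.1
  let y' := x.2.2.2
  if IsAdjacency a ∧ IsAdjacency y ∧ IsAdjacency y' then
    (∏ i, if c i = 0 then κ else 1 - κ) *
      ∏ p ∈ nodePairs n,
        (bernWeight (B (c p.1) (c p.2)) (a p.1 p.2) *
          bernWeight (if a p.1 p.2 then 1 - E (c p.1) (c p.2) else 0) (y p.1 p.2) *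
          bernWeight (if a p.1 p.2 then 1 - E (c p.1) (c p.2) else 0) (y' p.1 p.2))
  else 0

/-- The joint law of `(c, A, Y, Y*)` under the 2-group stochastic block model with connection
matrix `B`, observed twice with type II error matrix `E`. -/
noncomputable def law (n : ℕ) (κ : ℝ) (B E : Matrix (Fin 2) (Fin 2) ℝ) :
    Measure (Labels n × BinMat n × BinMat n × BinMat n) :=
  ∑ x, ENNReal.ofReal (massFun n κ B E x) • Measure.dirac x

/-- Connection probabilities of the construct network on `n` nodes. -/
noncomputable def connMatrix (n : ℕ) (q μ₁ μ₂ : ℝ) : Matrix (Fin 2) (Fin 2) ℝ :=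
  !![q + μ₁ / √n, q; q, q + μ₂ / √n]

/-- Type II error rates on `n` nodes. -/
noncomputable def errMatrix (n : ℕ) (β γ₁ γ₂ : ℝ) : Matrix (Fin 2) (Fin 2) ℝ :=
  !![β - γ₁ / √n, β; β, β - γ₂ / √n]

section Statistics

variable {n : ℕ}

/-- The number `n_g` of nodes in group `g`. -/
def groupSize (c : Labels n) (g : Fin 2) : ℕ := (Finset.univ.filter fun i => c i = g).card

/-- The pairs `i < j` inside group `g`. -/
def withinPairs (c : Labels n) (g : Fin 2) : Finset (Fin n × Fin n) :=
  (nodePairs n).filter fun p => c p.1 = g ∧ c p.2 = g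

/-- The pairs `i < j` with one node in each group. -/
def betweenPairs (c : Labels n) : Finset (Fin n × Fin n) :=
  (nodePairs n).filter fun p => c p.1 ≠ c p.2

/-- `N_g = binom(n_g, 2)`. -/
def numWithin (c : Labels n) (g : Fin 2) : ℝ := ((groupSize c g).choose 2 : ℝ)

/-- `N_b = n₁ n₂`. -/
def numBetween (c : Labels n) : ℝ := (groupSize c 0 : ℝ) * (groupSize c 1 : ℝ)

/-- A matrix entry as a real number `0` or `1`. -/
def entry (b : Bool) : ℝ := if b then 1 else 0

/-- The first moment statistic `û₁` over a block of pairs `S` with normalisation `N`. -/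
noncomputable def moment₁ (N : ℝ) (S : Finset (Fin n × Fin n)) (y : BinMat n) : ℝ :=
  1 / N * ∑ p ∈ S, entry (y p.1 p.2)

/-- The second moment statistic `û₂` over a block of pairs `S` with normalisation `N`. -/
noncomputable def moment₂ (N : ℝ) (S : Finset (Fin n × Fin n)) (y y' : BinMat n) : ℝ :=
  1 / (2 * N) * ∑ p ∈ S, |entry (y p.1 p.2) - entry (y' p.1 p.2)|

/-- `β̂_g = û_{2,g} / û_{1,g}`. -/
noncomputable def betaHat (c : Labels n) (g : Fin 2) (y y' : BinMat n) : ℝ :=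
  moment₂ (numWithin c g) (withinPairs c g) y y' / moment₁ (numWithin c g) (withinPairs c g) y

/-- `β̂_b = û_{2,b} / û_{1,b}`. -/
noncomputable def betaHatBetween (c : Labels n) (y y' : BinMat n) : ℝ :=
  moment₂ (numBetween c) (betweenPairs c) y y' / moment₁ (numBetween c) (betweenPairs c) y

/-- `γ̂_g = √n (β̂_b - β̂_g)`. -/
noncomputable def gammaHat (c : Labels n) (g : Fin 2) (y y' : BinMat n) : ℝ :=
  √n * (betaHatBetween c y y' - betaHat c g y y')

/-- The vector `(n (β̂_b - β), √n (γ̂₁ - γ₁), √n (γ̂₂ - γ₂))`. -/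
noncomputable def pivot (β γ₁ γ₂ : ℝ) (c : Labels n) (y y' : BinMat n) :
    EuclideanSpace ℝ (Fin 3) :=
  !₂[(n : ℝ) * (betaHatBetween c y y' - β),
    √n * (gammaHat c 0 y y' - γ₁),
    √n * (gammaHat c 1 y y' - γ₂)]

end Statistics

/-- Limiting covariance of the pair `(Y i j, |Y i j - Y* i j| / 2)`, with `qs = (1 - β) q`. -/
noncomputable def sigmaU (β qs : ℝ) : Matrix (Fin 2) (Fin 2) ℝ :=
  !![qs * (1 - qs), (1 / 2 - qs) * β * qs;
    (1 / 2 - qs) * β * qs, (1 / 2 - β * qs) * β * qs]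

/-- The block diagonal matrix `diag(a⁻¹ S, b⁻¹ S, d⁻¹ S)` with `a = κ² / 2`, `b = (1 - κ)² / 2`
and `d = κ (1 - κ)`. -/
noncomputable def momentCov (κ : ℝ) (S : Matrix (Fin 2) (Fin 2) ℝ) : Matrix (Fin 6) (Fin 6) ℝ :=
  let a := 1 / 2 * κ ^ 2
  let b := 1 / 2 * (1 - κ) ^ 2
  let d := κ * (1 - κ)
  !![a⁻¹ * S 0 0, a⁻¹ * S 0 1, 0, 0, 0, 0;
    a⁻¹ * S 1 0, a⁻¹ * S 1 1, 0, 0, 0, 0;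
    0, 0, b⁻¹ * S 0 0, b⁻¹ * S 0 1, 0, 0;
    0, 0, b⁻¹ * S 1 0, b⁻¹ * S 1 1, 0, 0;
    0, 0, 0, 0, d⁻¹ * S 0 0, d⁻¹ * S 0 1;
    0, 0, 0, 0, d⁻¹ * S 1 0, d⁻¹ * S 1 1]

/-- The Jacobian matrix of `h (u, v, w, x, y, z) = (z / y, z / y - v / u, z / y - x / w)`, the map
which sends the moments `(û_{1,1}, û_{2,1}, û_{1,2}, û_{2,2}, û_{1,b}, û_{2,b})` to
`(β̂_b, β̂_b - β̂₁, β̂_b - β̂₂)`. -/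
noncomputable def jacobian (u v w x y z : ℝ) : Matrix (Fin 3) (Fin 6) ℝ :=
  !![0, 0, 0, 0, -(z / y ^ 2), 1 / y;
    v / u ^ 2, -(1 / u), 0, 0, -(z / y ^ 2), 1 / y;
    0, 0, x / w ^ 2, -(1 / w), -(z / y ^ 2), 1 / y]

/-- The asymptotic covariance `Σ_β` given by the delta method. -/
noncomputable def sigmaBeta (κ q β : ℝ) : Matrix (Fin 3) (Fin 3) ℝ :=
  let qs := (1 - β) * q
  let D := jacobian qs (β * qs) qs (β * qs) qs (β * qs)
  D * momentCov κ (sigmaU β qs) * D.transpose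

end NoisySBM

/-!
For a block `x` of node pairs (inside group 1, inside group 2, between the groups; numbered `0`, `1`,
`2` below) with type II error rate `e`, the residual `|Y - Y*| / 2 - e Y` of a pair has conditional
mean zero, because `E |Y - Y*| / 2 = e E Y`. The normalisations `N_x` cancel in `β̂_x`, and
`n (β̂_x - e) = (n⁻¹ ∑ residuals) / (n⁻² ∑ Y)` whenever the denominator does not vanish
(`mul_moment_ratio_sub`). With `e = β - γ_g / √n` inside the groups, the pivot is therefore
`(z₂, z₂ - z₀, z₂ - z₁)` for these three quotients `z_x` (`pivot_eq_truncatedPivot`).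

The six sums (`blockSums`) are handled together by characteristic functions. Given the labels the
node pairs are independent, so that a characteristic function is a mean over the labels of products
`∏_x φ_x ^ N_x` (`integral_law_prod`, `integral_exp_inner_blockSums`). A second-order expansion
gives `n² (φ_x - 1) → - β q* s² / 4 + i u q*`, where `q* = (1 - β) q` (the residuals have limiting
variance `β q* / 2`), and `N_x / n²` converges in mean to `κ_x`, that is, to `κ² / 2`,
`(1 - κ)² / 2` or `κ (1 - κ)`, by a variance bound for the group sizes. Since the exponential is
`1`-Lipschitz on the left half-plane, these two facts give the limit of the mean
(`tendsto_sum_labelWeight_prod_pow`). By Lévy's theorem the block sums converge in law to a Gaussian vector whose last three coordinates,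
the limits of the denominators, are positive constants.

The pivot agrees with a continuous function of the block sums except where a denominator is less
than or equal to half its limit, an event of vanishing probability. The continuous mapping theorem
thus applies, and the image of the Gaussian limit is identified by the quadratic form of `Σ_β`,
which is the positive combination `∑_x β / (2 q* κ_x) w_x²` of the squares of three independent
linear forms `w_x` (`quadForm_sigmaBeta`, `map_truncatedPivot`); this also shows that `Σ_β` is
positive definite. Finally `Y = Y*` requires agreement at all node pairs, which has at most
geometrically small probability in their number, so that conditioning on `Y ≠ Y*` changes nothing
in the limit.
-/

namespace NoisySBM

/-! ### Blocks of node pairs -/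

/-- The block of a pair of labels: `0` and `1` for pairs inside group `0` and `1`, and `2` for
pairs between the groups. -/
def block (g h : Fin 2) : Fin 3 := if g = h then (if g = 0 then 0 else 1) else 2

/-- The pairs `i < j` lying in a given block. -/
def blockPairs {n : ℕ} (c : Labels n) (x : Fin 3) : Finset (Fin n × Fin n) :=
  (nodePairs n).filter fun p => block (c p.1) (c p.2) = x

lemma withinPairs_zero {n : ℕ} (c : Labels n) : withinPairs c 0 = blockPairs c 0 := by
  unfold withinPairs blockPairs
  congr 1; ext p
  generalize c p.1 = g; generalize c p.2 = h
  revert g h; decide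

lemma withinPairs_one {n : ℕ} (c : Labels n) : withinPairs c 1 = blockPairs c 1 := by
  unfold withinPairs blockPairs
  congr 1; ext p
  generalize c p.1 = g; generalize c p.2 = h
  revert g h; decide

lemma betweenPairs_eq {n : ℕ} (c : Labels n) : betweenPairs c = blockPairs c 2 := by
  unfold betweenPairs blockPairs
  congr 1; ext p
  generalize c p.1 = g; generalize c p.2 = h
  revert g h; decide

/-- A symmetric function summed over all pairs, in terms of its sum over the pairs `i < j`. -/
lemma sum_univ_eq_diag_add_nodePairs {n : ℕ} (F : Fin n → Fin n → ℝ) (hF : ∀ i j, F i j = F j i) :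
    ∑ i, ∑ j, F i j = ∑ i, F i i + 2 * ∑ p ∈ nodePairs n, F p.1 p.2 := by
  have h1 : ∀ i j, F i j = (if i < j then F i j else 0) + (if j < i then F j i else 0)
      + (if i = j then F i i else 0) := by
    intro i j
    rcases lt_trichotomy i j with h | h | h
    · simp [h, h.not_gt, h.ne]
    · simp [h]
    · simp [h, h.not_gt, h.ne', hF i j]
  have h2 : ∑ p ∈ nodePairs n, F p.1 p.2 = ∑ i, ∑ j, if i < j then F i j else 0 := by
    rw [nodePairs, Finset.sum_filter, ← Finset.univ_product_univ, Finset.sum_product]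
  have h3 : ∑ i, ∑ j, (if j < i then F j i else 0) = ∑ i, ∑ j, if i < j then F i j else 0 :=
    Finset.sum_comm
  calc ∑ i, ∑ j, F i j
      = ∑ i, ∑ j, ((if i < j then F i j else 0) + (if j < i then F j i else 0)
        + (if i = j then F i i else 0)) := by
        refine Finset.sum_congr rfl fun i _ => Finset.sum_congr rfl fun j _ => h1 i j
    _ = _ := by
        simp only [Finset.sum_add_distrib, h3, h2, Finset.sum_ite_eq, Finset.mem_univ, if_true]
        ring

lemma groupSize_cast {n : ℕ} (c : Labels n) (g : Fin 2) :
    (groupSize c g : ℝ) = ∑ i, if c i = g then 1 else 0 := by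
  simp [groupSize]

lemma groupSize_one_cast {n : ℕ} (c : Labels n) :
    (groupSize c 1 : ℝ) = n - groupSize c 0 := by
  rw [groupSize_cast, groupSize_cast, eq_sub_iff_add_eq, ← Finset.sum_add_distrib]
  have : ∀ i, ((if c i = 1 then 1 else 0) + (if c i = 0 then 1 else 0) : ℝ) = 1 := by
    intro i
    generalize c i = g
    fin_cases g <;> simp
  simp [this]

lemma card_withinPairs {n : ℕ} (c : Labels n) (g : Fin 2) :
    ((withinPairs c g).card : ℝ) = numWithin c g := by
  have h := sum_univ_eq_diag_add_nodePairs
    (fun i j => (if c i = g then 1 else 0) * (if c j = g then 1 else 0))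
    (fun i j => mul_comm _ _)
  rw [← Finset.sum_mul_sum, ← groupSize_cast] at h
  have h1 : ∑ i, ((if c i = g then 1 else 0) * (if c i = g then 1 else 0) : ℝ)
      = groupSize c g := by
    rw [groupSize_cast]; refine Finset.sum_congr rfl fun i _ => by split_ifs <;> simp
  have h2 : ∑ p ∈ nodePairs n, ((if c p.1 = g then 1 else 0) * (if c p.2 = g then 1 else 0) : ℝ)
      = (withinPairs c g).card := by
    rw [withinPairs, Finset.card_filter]; push_cast
    refine Finset.sum_congr rfl fun p _ => by split_ifs <;> simp_all
  rw [h1, h2] at h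
  rw [numWithin, Nat.cast_choose_two]
  linarith

lemma card_betweenPairs {n : ℕ} (c : Labels n) :
    ((betweenPairs c).card : ℝ) = numBetween c := by
  have h := sum_univ_eq_diag_add_nodePairs
    (fun i j => (if c i = 0 then 1 else 0) * (if c j = 1 then 1 else 0) +
      (if c j = 0 then 1 else 0) * (if c i = 1 then 1 else 0)) (fun i j => add_comm _ _)
  simp only [Finset.sum_add_distrib] at h
  rw [← Finset.sum_mul_sum, Finset.sum_comm (γ := Fin n), ← Finset.sum_mul_sum,
    ← groupSize_cast, ← groupSize_cast, ← Finset.sum_add_distrib, ← Finset.sum_add_distrib] at h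
  have h1 : ∑ i, ((if c i = 0 then 1 else 0) * (if c i = 1 then 1 else 0)
      + (if c i = 0 then 1 else 0) * (if c i = 1 then 1 else 0) : ℝ) = 0 := by
    refine Finset.sum_eq_zero fun i _ => by split_ifs <;> simp_all
  have h2 : ∑ p ∈ nodePairs n, ((if c p.1 = 0 then 1 else 0) * (if c p.2 = 1 then 1 else 0)
      + (if c p.2 = 0 then 1 else 0) * (if c p.1 = 1 then 1 else 0) : ℝ)
      = (betweenPairs c).card := by
    rw [betweenPairs, Finset.card_filter]; push_cast
    refine Finset.sum_congr rfl fun p _ => ?_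
    generalize c p.1 = g; generalize c p.2 = k
    fin_cases g <;> fin_cases k <;> simp
  rw [h1, h2] at h
  rw [numBetween]
  linarith

/-! ### Integrals against the law of the model -/

/-- The probability of a label vector. -/
noncomputable def labelWeight {n : ℕ} (κ : ℝ) (c : Labels n) : ℝ :=
  ∏ i, if c i = 0 then κ else 1 - κ

/-- The expectation of `h (Y i j) (Y* i j)` for a pair with connection probability `p` and type II
error rate `e`. -/
noncomputable def pairExp (p e : ℝ) (h : Bool → Bool → ℂ) : ℂ :=
  ∑ a, ∑ b, ∑ b', ((bernWeight p a * bernWeight (if a then 1 - e else 0) b *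
    bernWeight (if a then 1 - e else 0) b' : ℝ) : ℂ) * h b b'

lemma pairExp_eq (p e : ℝ) (h : Bool → Bool → ℂ) :
    pairExp p e h = ((p * (1 - e) ^ 2 : ℝ) : ℂ) * h true true
      + ((p * e * (1 - e) : ℝ) : ℂ) * h true false + ((p * e * (1 - e) : ℝ) : ℂ) * h false true
      + ((1 - p + p * e ^ 2 : ℝ) : ℂ) * h false false := by
  simp [pairExp, bernWeight]
  ring

lemma sum_prod_eq_prod_sum {ι α : Type*} [Fintype ι] [DecidableEq ι] [Fintype α]
    {R : Type*} [CommSemiring R] (F : ι → α → R) :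
    ∑ f : ι → α, ∏ i, F i (f i) = ∏ i, ∑ k, F i k := by
  classical
  rw [Finset.prod_univ_sum, Fintype.piFinset_univ]

lemma sum_labelWeight {n : ℕ} (κ : ℝ) : ∑ c : Labels n, labelWeight κ c = 1 := by
  unfold labelWeight
  rw [sum_prod_eq_prod_sum (fun _ g => if g = 0 then κ else 1 - κ)]
  simp

lemma labelWeight_nonneg {n : ℕ} {κ : ℝ} (hκ : κ ∈ Set.Icc (0 : ℝ) 1) (c : Labels n) :
    0 ≤ labelWeight κ c := by
  refine Finset.prod_nonneg fun i _ => ?_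
  split_ifs <;> linarith [hκ.1, hκ.2]

/-- An adjacency matrix is determined by its entries above the diagonal, which are arbitrary. -/
def adjacencyEquiv (n : ℕ) :
    {a : BinMat n // IsAdjacency a} ≃ ({p // p ∈ nodePairs n} → Bool) where
  toFun a p := a.1 p.1.1 p.1.2
  invFun f := ⟨fun i j => if h : i < j then f ⟨(i, j), by simpa [nodePairs] using h⟩
      else if h' : j < i then f ⟨(j, i), by simpa [nodePairs] using h'⟩ else false, by
    refine ⟨fun i => by simp, fun i j => ?_⟩
    rcases lt_trichotomy i j with h | h | h
    · simp [h, h.not_gt]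
    · simp [h]
    · simp [h, h.not_gt]⟩
  left_inv a := by
    obtain ⟨a, ha⟩ := a
    ext i j
    rcases lt_trichotomy i j with h | h | h
    · simp [h]
    · simp [h, ha.1]
    · simp [h, h.not_gt, ha.2 i j]
  right_inv f := by
    ext ⟨p, hp⟩
    have : p.1 < p.2 := by simpa [nodePairs] using hp
    simp [this]

open Classical in
lemma sum_adjacency_prod {n : ℕ} (F : {p // p ∈ nodePairs n} → Bool → ℂ) :
    ∑ a : BinMat n, (if IsAdjacency a then ∏ p, F p (a p.1.1 p.1.2) else 0)
      = ∏ p, ∑ b, F p b := by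
  rw [← sum_prod_eq_prod_sum, ← Finset.sum_filter]
  rw [← Finset.sum_subtype_eq_sum_filter]
  simp only [Finset.subtype_univ]
  exact Fintype.sum_equiv (adjacencyEquiv n) _ _ fun a => rfl

lemma massFun_nonneg {n : ℕ} {κ : ℝ} (hκ : κ ∈ Set.Icc (0 : ℝ) 1)
    {B E : Matrix (Fin 2) (Fin 2) ℝ} (hB : ∀ g h, B g h ∈ Set.Icc (0 : ℝ) 1)
    (hE : ∀ g h, E g h ∈ Set.Icc (0 : ℝ) 1) (x : Labels n × BinMat n × BinMat n × BinMat n) :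
    0 ≤ massFun n κ B E x := by
  have hb : ∀ (p : ℝ) (b : Bool), p ∈ Set.Icc (0 : ℝ) 1 → 0 ≤ bernWeight p b := by
    intro p b hp
    unfold bernWeight
    split_ifs <;> linarith [hp.1, hp.2]
  have he : ∀ (a : Bool) g h, (if a then 1 - E g h else 0) ∈ Set.Icc (0 : ℝ) 1 := by
    intro a g h
    split_ifs
    · exact ⟨by linarith [(hE g h).2], by linarith [(hE g h).1]⟩
    · simp
  unfold massFun
  dsimp only
  split_ifs
  · refine mul_nonneg (labelWeight_nonneg hκ x.1) (Finset.prod_nonneg fun p _ => ?_)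
    exact mul_nonneg (mul_nonneg (hb _ _ (hB _ _)) (hb _ _ (he _ _ _))) (hb _ _ (he _ _ _))
  · exact le_rfl

/-- For parameters in `[0, 1]` the point masses are nonnegative, so the truncation at zero in the
definition of `law` has no effect. -/
lemma integral_law {n : ℕ} {κ : ℝ} (hκ : κ ∈ Set.Icc (0 : ℝ) 1)
    {B E : Matrix (Fin 2) (Fin 2) ℝ} (hB : ∀ g h, B g h ∈ Set.Icc (0 : ℝ) 1)
    (hE : ∀ g h, E g h ∈ Set.Icc (0 : ℝ) 1)
    (f : Labels n × BinMat n × BinMat n × BinMat n → ℂ) :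
    ∫ x, f x ∂(law n κ B E) = ∑ x, (massFun n κ B E x : ℂ) * f x := by
  rw [law, integral_finsetSum_measure]
  · refine Finset.sum_congr rfl fun x _ => ?_
    rw [integral_smul_measure, integral_dirac, ENNReal.toReal_ofReal (massFun_nonneg hκ hB hE x)]
    simp
  · intro x _
    exact (integrable_dirac (by simp)).smul_measure (by simp)

/-- Given the labels, the pairs of observed entries are independent: the expectation of a product
over the node pairs is the mean over the labels of the product of the expectations. -/
lemma integral_law_prod {n : ℕ} {κ : ℝ} (hκ : κ ∈ Set.Icc (0 : ℝ) 1)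
    {B E : Matrix (Fin 2) (Fin 2) ℝ} (hB : ∀ g h, B g h ∈ Set.Icc (0 : ℝ) 1)
    (hE : ∀ g h, E g h ∈ Set.Icc (0 : ℝ) 1)
    (h : Labels n → Fin n × Fin n → Bool → Bool → ℂ) :
    ∫ x, ∏ p ∈ nodePairs n, h x.1 p (x.2.2.1 p.1 p.2) (x.2.2.2 p.1 p.2) ∂(law n κ B E)
      = ∑ c : Labels n, (labelWeight κ c : ℂ) *
          ∏ p ∈ nodePairs n, pairExp (B (c p.1) (c p.2)) (E (c p.1) (c p.2)) (h c p) := by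
  classical
  rw [integral_law hκ hB hE, Fintype.sum_prod_type]
  refine Finset.sum_congr rfl fun c _ => ?_
  simp only [Fintype.sum_prod_type]
  let G : {p // p ∈ nodePairs n} → Bool → Bool → Bool → ℂ := fun p a b b' =>
    ((bernWeight (B (c p.1.1) (c p.1.2)) a *
      bernWeight (if a then 1 - E (c p.1.1) (c p.1.2) else 0) b *
      bernWeight (if a then 1 - E (c p.1.1) (c p.1.2) else 0) b' : ℝ) : ℂ) * h c p.1 b b'
  have key : ∀ a y y' : BinMat n, (massFun n κ B E (c, a, y, y') : ℂ) *
      ∏ p ∈ nodePairs n, h c p (y p.1 p.2) (y' p.1 p.2) =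
      (labelWeight κ c : ℂ) * (if IsAdjacency a then (if IsAdjacency y then
        (if IsAdjacency y' then
          ∏ p : {p // p ∈ nodePairs n}, G p (a p.1.1 p.1.2) (y p.1.1 p.1.2) (y' p.1.1 p.1.2)
        else 0) else 0) else 0) := by
    intro a y y'
    by_cases h1 : IsAdjacency a
    · by_cases h2 : IsAdjacency y
      · by_cases h3 : IsAdjacency y'
        · simp only [massFun, h1, h2, h3, and_self, if_true, G]
          rw [← Finset.prod_coe_sort (nodePairs n), ← Finset.prod_coe_sort (nodePairs n),
            Complex.ofReal_mul, mul_assoc]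
          congr 1
          exact (congrArg (· * _) (Complex.ofReal_prod _ _)).trans Finset.prod_mul_distrib.symm
        · simp [massFun, h3]
      · simp [massFun, h2]
    · simp [massFun, h1]
  have pull : ∀ (Q : Prop) [Decidable Q] (f : BinMat n → ℂ),
      ∑ y, (if Q then f y else 0) = if Q then ∑ y, f y else 0 := by
    intro Q _ f; split_ifs <;> simp
  simp only [key, ← Finset.mul_sum, pull]
  congr 1
  have e2 : ∀ a : BinMat n, ∑ y : BinMat n, (if IsAdjacency y then
      ∏ p : {p // p ∈ nodePairs n}, ∑ b', G p (a p.1.1 p.1.2) (y p.1.1 p.1.2) b' else 0)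
      = ∏ p : {p // p ∈ nodePairs n}, ∑ b, ∑ b', G p (a p.1.1 p.1.2) b b' := fun a =>
    sum_adjacency_prod (fun p b => ∑ b', G p (a p.1.1 p.1.2) b b')
  have e3 := sum_adjacency_prod (fun p a => ∑ b, ∑ b', G p a b b')
  have e1 : ∀ a y : BinMat n, ∑ y' : BinMat n, (if IsAdjacency y' then
      ∏ p : {p // p ∈ nodePairs n}, G p (a p.1.1 p.1.2) (y p.1.1 p.1.2) (y' p.1.1 p.1.2) else 0)
      = ∏ p : {p // p ∈ nodePairs n}, ∑ b', G p (a p.1.1 p.1.2) (y p.1.1 p.1.2) b' := fun a y =>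
    sum_adjacency_prod (fun p b' => G p (a p.1.1 p.1.2) (y p.1.1 p.1.2) b')
  simp only [e1, e2, e3]
  rw [← Finset.prod_coe_sort (nodePairs n)]
  rfl

/-! ### Concentration of the block sizes -/

/-- The limit of the proportions of node pairs (relative to `n²`) in the three blocks. -/
noncomputable def blockFrac (κ : ℝ) : Fin 3 → ℝ := ![κ ^ 2 / 2, (1 - κ) ^ 2 / 2, κ * (1 - κ)]

lemma sum_labelWeight_mul_prod {n : ℕ} (κ : ℝ) (F : Fin n → Fin 2 → ℝ) :
    ∑ c : Labels n, labelWeight κ c * ∏ i, F i (c i)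
      = ∏ i, (κ * F i 0 + (1 - κ) * F i 1) := by
  simp only [labelWeight, ← Finset.prod_mul_distrib]
  rw [sum_prod_eq_prod_sum (fun i g => (if g = 0 then κ else 1 - κ) * F i g)]
  simp

/-- The size of the first group has mean `n κ` and variance at most `n`. -/
lemma sum_labelWeight_mul_sq_le {n : ℕ} {κ : ℝ} (hκ : κ ∈ Set.Icc (0 : ℝ) 1) :
    ∑ c : Labels n, labelWeight κ c * ((groupSize c 0 : ℝ) - n * κ) ^ 2 ≤ n := by
  let a : Fin 2 → ℝ := fun g => (if g = 0 then 1 else 0) - κ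
  have h1 : ∀ c : Labels n, (groupSize c 0 : ℝ) - n * κ = ∑ i, a (c i) := by
    intro c; simp [a, groupSize_cast]
  -- Centred indicators of distinct nodes are uncorrelated.
  have h2 : ∀ i j : Fin n, i ≠ j → ∑ c : Labels n, labelWeight κ c * (a (c i) * a (c j)) = 0 := by
    intro i j hij
    have := sum_labelWeight_mul_prod κ (fun k g => (if k = i then a g else 1) *
      (if k = j then a g else 1))
    simp only [Finset.prod_mul_distrib, Finset.prod_ite_eq', Finset.mem_univ, if_true] at this
    rw [this]
    refine Finset.prod_eq_zero (Finset.mem_univ i) ?_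
    simp [hij, a]
    ring
  have h3 : ∀ i : Fin n, ∑ c : Labels n, labelWeight κ c * (a (c i) * a (c i)) ≤ 1 := by
    intro i
    rw [← sum_labelWeight (n := n) κ]
    refine Finset.sum_le_sum fun c _ => mul_le_of_le_one_right (labelWeight_nonneg hκ c) ?_
    have : |a (c i)| ≤ 1 := by
      simp only [a]; rw [abs_le]; split_ifs <;> constructor <;> linarith [hκ.1, hκ.2]
    rw [← pow_two]
    exact (sq_le_one_iff_abs_le_one _).2 this
  calc ∑ c : Labels n, labelWeight κ c * ((groupSize c 0 : ℝ) - n * κ) ^ 2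
      = ∑ i, ∑ j, ∑ c : Labels n, labelWeight κ c * (a (c i) * a (c j)) := by
        simp only [h1, pow_two (∑ i, _), Finset.sum_mul_sum]
        simp only [Finset.mul_sum]
        rw [Finset.sum_comm]
        refine Finset.sum_congr rfl fun i _ => Finset.sum_comm
    _ ≤ ∑ _i : Fin n, (1 : ℝ) := by
        refine Finset.sum_le_sum fun i _ => ?_
        rw [Finset.sum_eq_single i (fun j _ hj => h2 i j hj.symm) (by simp)]
        exact h3 i
    _ = n := by simp

lemma sum_labelWeight_mul_abs_le {n : ℕ} (hn : 0 < n) {κ : ℝ} (hκ : κ ∈ Set.Icc (0 : ℝ) 1) :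
    ∑ c : Labels n, labelWeight κ c * |(groupSize c 0 : ℝ) / n - κ| ≤ 1 / √n := by
  have hn' : (0 : ℝ) < n := by exact_mod_cast hn
  have hs : 0 < √(n : ℝ) := Real.sqrt_pos.2 hn'
  have hss : √(n : ℝ) ^ 2 = n := Real.sq_sqrt hn'.le
  set s := √(n : ℝ) with hsdef
  -- `|X| ≤ (X² / √n + √n) / 2` reduces the first absolute moment to the second moment.
  have h1 : ∀ c : Labels n, |(groupSize c 0 : ℝ) / n - κ|
      ≤ ((groupSize c 0 : ℝ) - n * κ) ^ 2 / (2 * s ^ 3) + 1 / (2 * s) := by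
    intro c
    have e : (groupSize c 0 : ℝ) / n - κ = ((groupSize c 0 : ℝ) - n * κ) / s ^ 2 := by
      rw [hss]; field_simp
    rw [e, abs_div, abs_of_pos (pow_pos hs 2), ← sq_abs (_ - _)]
    generalize |(groupSize c 0 : ℝ) - n * κ| = X
    rw [div_add_div _ _ (by positivity) (by positivity), div_le_div_iff₀ (by positivity)
      (by positivity)]
    nlinarith [mul_nonneg (pow_pos hs 3).le (sq_nonneg (X - s))]
  calc ∑ c : Labels n, labelWeight κ c * |(groupSize c 0 : ℝ) / n - κ|
      ≤ ∑ c : Labels n, labelWeight κ c *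
        (((groupSize c 0 : ℝ) - n * κ) ^ 2 / (2 * s ^ 3) + 1 / (2 * s)) :=
        Finset.sum_le_sum fun c _ => mul_le_mul_of_nonneg_left (h1 c) (labelWeight_nonneg hκ c)
    _ = (∑ c : Labels n, labelWeight κ c * ((groupSize c 0 : ℝ) - n * κ) ^ 2) / (2 * s ^ 3)
        + (∑ c : Labels n, labelWeight κ c) * (1 / (2 * s)) := by
        rw [Finset.sum_div, Finset.sum_mul, ← Finset.sum_add_distrib]
        refine Finset.sum_congr rfl fun c _ => by ring
    _ ≤ s ^ 2 / (2 * s ^ 3) + 1 * (1 / (2 * s)) := by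
        rw [sum_labelWeight]
        gcongr
        rw [hss]
        exact sum_labelWeight_mul_sq_le hκ
    _ = 1 / s := by field_simp; norm_num

lemma card_blockPairs_le {n : ℕ} (c : Labels n) (x : Fin 3) :
    (blockPairs c x).card ≤ n ^ 2 := by
  calc (blockPairs c x).card ≤ (Finset.univ : Finset (Fin n × Fin n)).card :=
        Finset.card_le_card (Finset.subset_univ _)
    _ = n ^ 2 := by simp [pow_two]

lemma abs_card_blockPairs_sub_le {n : ℕ} (hn : 0 < n) {κ : ℝ} (hκ : κ ∈ Set.Icc (0 : ℝ) 1)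
    (c : Labels n) (x : Fin 3) :
    |((blockPairs c x).card : ℝ) / n ^ 2 - blockFrac κ x|
      ≤ |(groupSize c 0 : ℝ) / n - κ| + 1 / n := by
  have hn' : (0 : ℝ) < n := by exact_mod_cast hn
  have hk0 : 0 ≤ (groupSize c 0 : ℝ) / n := by positivity
  have hk1 : (groupSize c 0 : ℝ) / n ≤ 1 := by
    rw [div_le_one hn']
    exact_mod_cast (Finset.card_le_univ _).trans (by simp)
  have c0 : ((blockPairs c 0).card : ℝ) = groupSize c 0 * (groupSize c 0 - 1) / 2 := by
    rw [← withinPairs_zero, card_withinPairs, numWithin, Nat.cast_choose_two]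
  have c1 : ((blockPairs c 1).card : ℝ) = (n - groupSize c 0) * (n - groupSize c 0 - 1) / 2 := by
    rw [← withinPairs_one, card_withinPairs, numWithin, Nat.cast_choose_two, groupSize_one_cast]
  have c2 : ((blockPairs c 2).card : ℝ) = groupSize c 0 * (n - groupSize c 0) := by
    rw [← betweenPairs_eq, card_betweenPairs, numBetween, groupSize_one_cast]
  have hK : (groupSize c 0 : ℝ) = (groupSize c 0 : ℝ) / n * n := by field_simp
  have hi : (0 : ℝ) < 1 / n := by positivity
  have hin : (n : ℝ) * (1 / n) = 1 := by field_simp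
  generalize (groupSize c 0 : ℝ) / n = k at *
  rw [hK] at c0 c1 c2
  obtain ⟨hκ0, hκ1⟩ := hκ
  have split : ∀ u v : ℝ, |u| ≤ 1 → 0 ≤ v → v ≤ 1 → |u * (k - κ) - v * (1 / n)|
      ≤ |k - κ| + 1 / n := by
    intro u v hu hv0 hv1
    refine (abs_sub _ _).trans (add_le_add ?_ ?_)
    · rw [abs_mul]; exact mul_le_of_le_one_left (abs_nonneg _) hu
    · rw [abs_of_nonneg (by positivity)]; exact mul_le_of_le_one_left hi.le hv1
  fin_cases x
  · have : ((blockPairs c 0).card : ℝ) / n ^ 2 - blockFrac κ 0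
        = ((k + κ) / 2) * (k - κ) - (k / 2) * (1 / n) := by
      rw [c0]; simp only [blockFrac, Matrix.cons_val_zero]; field_simp; ring
    simp only [Fin.zero_eta]
    rw [this]
    exact split _ _ (by rw [abs_le]; constructor <;> linarith) (by linarith) (by linarith)
  · have : ((blockPairs c 1).card : ℝ) / n ^ 2 - blockFrac κ 1
        = (-(1 - k + (1 - κ)) / 2) * (k - κ) - ((1 - k) / 2) * (1 / n) := by
      rw [c1]; simp only [blockFrac, Matrix.cons_val_one, Matrix.cons_val_zero]; field_simp; ring
    simp only [Fin.mk_one]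
    rw [this]
    exact split _ _ (by rw [abs_le]; constructor <;> linarith) (by linarith) (by linarith)
  · have : ((blockPairs c 2).card : ℝ) / n ^ 2 - blockFrac κ 2
        = (1 - k - κ) * (k - κ) - 0 * (1 / n) := by
      rw [c2]; simp only [blockFrac, Matrix.cons_val]; field_simp; ring
    simp only [Fin.reduceFinMk]
    rw [this]
    exact split _ _ (by rw [abs_le]; constructor <;> linarith) (by linarith) (by linarith)

/-- The proportions of node pairs in the blocks converge in mean. -/
lemma tendsto_sum_labelWeight_blockPairs {κ : ℝ} (hκ : κ ∈ Set.Icc (0 : ℝ) 1) (x : Fin 3) :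
    Tendsto (fun n : ℕ => ∑ c : Labels n, labelWeight κ c *
      |((blockPairs c x).card : ℝ) / n ^ 2 - blockFrac κ x|) atTop (𝓝 0) := by
  have hlim : Tendsto (fun n : ℕ => 1 / √(n : ℝ) + 1 / (n : ℝ)) atTop (𝓝 0) := by
    have h1 : Tendsto (fun n : ℕ => 1 / √(n : ℝ)) atTop (𝓝 0) := by
      simp only [one_div]
      exact (Real.tendsto_sqrt_atTop.comp tendsto_natCast_atTop_atTop).inv_tendsto_atTop
    simpa using h1.add tendsto_one_div_atTop_nhds_zero_nat
  refine tendsto_of_tendsto_of_tendsto_of_le_of_le' tendsto_const_nhds hlim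
    (Eventually.of_forall fun n => Finset.sum_nonneg fun c _ =>
      mul_nonneg (labelWeight_nonneg hκ c) (abs_nonneg _)) ?_
  filter_upwards [eventually_gt_atTop 0] with n hn
  calc _ ≤ ∑ c : Labels n, labelWeight κ c * (|(groupSize c 0 : ℝ) / n - κ| + 1 / n) :=
        Finset.sum_le_sum fun c _ => mul_le_mul_of_nonneg_left
          (abs_card_blockPairs_sub_le hn hκ c x) (labelWeight_nonneg hκ c)
    _ = ∑ c : Labels n, labelWeight κ c * |(groupSize c 0 : ℝ) / n - κ|
        + (∑ c : Labels n, labelWeight κ c) * (1 / n) := by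
        rw [Finset.sum_mul, ← Finset.sum_add_distrib]
        exact Finset.sum_congr rfl fun c _ => by ring
    _ ≤ _ := by
        rw [sum_labelWeight, one_mul]
        gcongr
        exact sum_labelWeight_mul_abs_le hn hκ

/-! ### Limits of products over blocks -/

lemma norm_pow_sub_pow_le {a b : ℂ} (ha : ‖a‖ ≤ 1) (hb : ‖b‖ ≤ 1) (k : ℕ) :
    ‖a ^ k - b ^ k‖ ≤ k * ‖a - b‖ := by
  induction k with
  | zero => simp
  | succ k ih =>
    have e : a ^ (k + 1) - b ^ (k + 1) = a ^ k * (a - b) + (a ^ k - b ^ k) * b := by ring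
    calc ‖a ^ (k + 1) - b ^ (k + 1)‖ ≤ ‖a ^ k * (a - b)‖ + ‖(a ^ k - b ^ k) * b‖ := by
          rw [e]; exact norm_add_le _ _
      _ ≤ 1 * ‖a - b‖ + (k * ‖a - b‖) * 1 := by
          rw [norm_mul, norm_mul, norm_pow]
          gcongr
          exact pow_le_one₀ (norm_nonneg _) ha
      _ = _ := by push_cast; ring

lemma norm_prod_sub_prod_le {ι : Type*} (s : Finset ι) (a b : ι → ℂ) (ha : ∀ x, ‖a x‖ ≤ 1)
    (hb : ∀ x, ‖b x‖ ≤ 1) : ‖∏ x ∈ s, a x - ∏ x ∈ s, b x‖ ≤ ∑ x ∈ s, ‖a x - b x‖ := by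
  classical
  induction s using Finset.induction_on with
  | empty => simp
  | insert i s hi ih =>
    rw [Finset.prod_insert hi, Finset.prod_insert hi, Finset.sum_insert hi]
    have e : a i * ∏ x ∈ s, a x - b i * ∏ x ∈ s, b x
        = a i * (∏ x ∈ s, a x - ∏ x ∈ s, b x) + (a i - b i) * ∏ x ∈ s, b x := by ring
    calc _ ≤ ‖a i * (∏ x ∈ s, a x - ∏ x ∈ s, b x)‖ + ‖(a i - b i) * ∏ x ∈ s, b x‖ := by
          rw [e]; exact norm_add_le _ _
      _ ≤ 1 * (∑ x ∈ s, ‖a x - b x‖) + ‖a i - b i‖ * 1 := by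
          rw [norm_mul, norm_mul, norm_prod]
          gcongr
          · exact ha i
          · exact Finset.prod_le_one (fun _ _ => norm_nonneg _) fun x _ => hb x
      _ = _ := by ring

/-- The exponential is `1`-Lipschitz on the left half-plane. -/
lemma norm_exp_sub_exp_le {z w : ℂ} (hz : z.re ≤ 0) (hw : w.re ≤ 0) :
    ‖Complex.exp z - Complex.exp w‖ ≤ ‖z - w‖ := by
  have := (convex_halfSpace_re_le 0).norm_image_sub_le_of_norm_deriv_le (𝕜 := ℂ) (C := 1)
    (f := Complex.exp) (fun x _ => Complex.differentiable_exp x)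
    (fun x hx => by
      rw [Complex.deriv_exp, Complex.norm_exp]
      exact Real.exp_le_one_iff.2 hx) hw hz
  simpa using this

lemma tendsto_sq_mul_exp_sub_one_sub {θ : ℕ → ℂ} {ℓ : ℂ}
    (h : Tendsto (fun n : ℕ => (n : ℂ) * θ n) atTop (𝓝 ℓ)) :
    Tendsto (fun n : ℕ => (n : ℂ) ^ 2 * (Complex.exp (θ n) - 1 - θ n)) atTop
      (𝓝 (ℓ ^ 2 / 2)) := by
  have hθ : Tendsto θ atTop (𝓝 0) := by
    have : Tendsto (fun n : ℕ => (n : ℂ)⁻¹ * ((n : ℂ) * θ n)) atTop (𝓝 (0 * ℓ)) :=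
      tendsto_inv_atTop_nhds_zero_nat.mul h
    rw [zero_mul] at this
    refine this.congr' ?_
    filter_upwards [eventually_ne_atTop 0] with n hn
    have : (n : ℂ) ≠ 0 := by exact_mod_cast hn
    field_simp
  have hmain : Tendsto (fun n : ℕ => (n : ℂ) ^ 2 * (Complex.exp (θ n) - 1 - θ n - θ n ^ 2 / 2))
      atTop (𝓝 0) := by
    have hb : Tendsto (fun n : ℕ => ‖(n : ℂ) * θ n‖ ^ 2 * ‖θ n‖) atTop (𝓝 0) := by
      simpa using (h.norm.pow 2).mul hθ.norm
    refine squeeze_zero_norm' ?_ hb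
    filter_upwards [hθ.norm.eventually_le_const (show ‖(0 : ℂ)‖ < 1 by simp)] with n hn
    have h3 := Complex.exp_bound hn (n := 3) (by norm_num)
    have e : Complex.exp (θ n) - 1 - θ n - θ n ^ 2 / 2
        = Complex.exp (θ n) - ∑ m ∈ Finset.range 3, θ n ^ m / m.factorial := by
      simp [Finset.sum_range_succ, Nat.factorial]; ring
    rw [norm_mul, norm_mul, e, mul_pow, norm_pow, mul_assoc]
    gcongr
    refine h3.trans ?_
    rw [← pow_succ]
    refine mul_le_of_le_one_right (by positivity) ?_
    norm_num [Nat.factorial]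
  have := hmain.add ((h.pow 2).div_const 2)
  rw [zero_add] at this
  refine this.congr fun n => ?_
  ring

/-- If `n² (φ_x - 1) → z_x`, then `φ_x ^ N_x` is close to `exp (z_x N_x / n²)` uniformly in the
labels because `N_x ≤ n²`, and the latter is close to `exp (κ_x z_x)` in mean. -/
lemma tendsto_sum_labelWeight_prod_pow {κ : ℝ} (hκ : κ ∈ Set.Icc (0 : ℝ) 1)
    {φ : ℕ → Fin 3 → ℂ} {z : Fin 3 → ℂ} (hφ : ∀ᶠ n in atTop, ∀ x, ‖φ n x‖ ≤ 1)
    (hz : ∀ x, (z x).re ≤ 0)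
    (hlim : ∀ x, Tendsto (fun n : ℕ => (n : ℂ) ^ 2 * (φ n x - 1)) atTop (𝓝 (z x))) :
    Tendsto (fun n : ℕ => ∑ c : Labels n, (labelWeight κ c : ℂ) *
      ∏ x, φ n x ^ (blockPairs c x).card) atTop
      (𝓝 (∏ x, Complex.exp (blockFrac κ x * z x))) := by
  have hfrac : ∀ x, 0 ≤ blockFrac κ x := by
    intro x
    have := hκ.1
    have := hκ.2
    fin_cases x <;> simp [blockFrac] <;> positivity
  let ψ : ℕ → Fin 3 → ℂ := fun n x => Complex.exp (z x / (n : ℂ) ^ 2)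
  have hre : ∀ (x) (r : ℝ), 0 ≤ r → ((r : ℂ) * z x).re ≤ 0 := by
    intro x r hr
    rw [Complex.re_ofReal_mul]
    exact mul_nonpos_of_nonneg_of_nonpos hr (hz x)
  have hψ : ∀ n x, ‖ψ n x‖ ≤ 1 := by
    intro n x
    rw [Complex.norm_exp, Real.exp_le_one_iff]
    have := hre x (((n : ℝ) ^ 2)⁻¹) (by positivity)
    push_cast at this
    rwa [div_eq_inv_mul]
  have hψlim : ∀ x, Tendsto (fun n : ℕ => (n : ℂ) ^ 2 * (ψ n x - 1)) atTop (𝓝 (z x)) := by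
    intro x
    have h0 : Tendsto (fun n : ℕ => (n : ℂ) * (z x / (n : ℂ) ^ 2)) atTop (𝓝 0) := by
      have : Tendsto (fun n : ℕ => z x * (n : ℂ)⁻¹) atTop (𝓝 (z x * 0)) :=
        tendsto_inv_atTop_nhds_zero_nat.const_mul _
      rw [mul_zero] at this
      refine this.congr' ?_
      filter_upwards [eventually_ne_atTop 0] with n hn
      have : (n : ℂ) ≠ 0 := by exact_mod_cast hn
      field_simp
    have := (tendsto_sq_mul_exp_sub_one_sub h0).add_const (z x)
    simp only [ne_eq, OfNat.ofNat_ne_zero, not_false_eq_true, zero_pow, zero_div, zero_add] at this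
    refine this.congr' ?_
    filter_upwards [eventually_ne_atTop 0] with n hn
    have : (n : ℂ) ≠ 0 := by exact_mod_cast hn
    simp only [ψ]
    field_simp
    ring
  have hdiff : ∀ x, Tendsto (fun n : ℕ => (n : ℝ) ^ 2 * ‖φ n x - ψ n x‖) atTop (𝓝 0) := by
    intro x
    have := ((hlim x).sub (hψlim x)).norm
    rw [sub_self, norm_zero] at this
    refine this.congr fun n => ?_
    rw [← mul_sub, norm_mul, norm_pow, Complex.norm_natCast]
    congr 2; ring
  have hbound : Tendsto (fun n : ℕ => ∑ x, ((n : ℝ) ^ 2 * ‖φ n x - ψ n x‖ +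
      ‖z x‖ * ∑ c : Labels n, labelWeight κ c *
      |((blockPairs c x).card : ℝ) / n ^ 2 - blockFrac κ x|)) atTop (𝓝 0) := by
    have : Tendsto (fun n : ℕ => ∑ x, ((n : ℝ) ^ 2 * ‖φ n x - ψ n x‖ +
      ‖z x‖ * ∑ c : Labels n, labelWeight κ c *
      |((blockPairs c x).card : ℝ) / n ^ 2 - blockFrac κ x|)) atTop
      (𝓝 (∑ x : Fin 3, (0 + ‖z x‖ * 0))) :=
      tendsto_finsetSum _ fun x _ => (hdiff x).add
        ((tendsto_sum_labelWeight_blockPairs hκ x).const_mul _)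
    simpa using this
  rw [tendsto_iff_norm_sub_tendsto_zero]
  refine squeeze_zero' (Eventually.of_forall fun n => norm_nonneg _) ?_ hbound
  filter_upwards [hφ, eventually_gt_atTop 0] with n hφn hn
  have hn' : (0 : ℝ) < n := by exact_mod_cast hn
  have hone : ∑ c : Labels n, (labelWeight κ c : ℂ) = 1 := by
    exact_mod_cast sum_labelWeight (n := n) κ
  rw [← one_mul (∏ x, Complex.exp (blockFrac κ x * z x)), ← hone, Finset.sum_mul,
    ← Finset.sum_sub_distrib]
  have hc : ∀ c : Labels n, ‖∏ x, φ n x ^ (blockPairs c x).card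
      - ∏ x, Complex.exp (blockFrac κ x * z x)‖ ≤ ∑ x, ((n : ℝ) ^ 2 * ‖φ n x - ψ n x‖ +
      ‖z x‖ * |((blockPairs c x).card : ℝ) / n ^ 2 - blockFrac κ x|) := by
    intro c
    refine (norm_prod_sub_prod_le _ _ _ (fun x => ?_) fun x => ?_).trans ?_
    · rw [norm_pow]; exact pow_le_one₀ (norm_nonneg _) (hφn x)
    · rw [Complex.norm_exp, Real.exp_le_one_iff]; exact hre x _ (hfrac x)
    refine Finset.sum_le_sum fun x _ => ?_
    refine (norm_sub_le_norm_sub_add_norm_sub _ (ψ n x ^ (blockPairs c x).card) _).trans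
      (add_le_add ?_ ?_)
    · refine (norm_pow_sub_pow_le (hφn x) (hψ n x) _).trans ?_
      gcongr
      exact_mod_cast card_blockPairs_le c x
    · have e : ψ n x ^ (blockPairs c x).card
          = Complex.exp ((((blockPairs c x).card : ℝ) / n ^ 2 : ℝ) * z x) := by
        rw [← Complex.exp_nat_mul]; congr 1; push_cast; ring
      rw [e]
      refine (norm_exp_sub_exp_le (hre x _ (by positivity)) (hre x _ (hfrac x))).trans ?_
      rw [← sub_mul, norm_mul, ← Complex.ofReal_sub, Complex.norm_real, Real.norm_eq_abs, mul_comm]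
  calc _ ≤ ∑ c : Labels n, labelWeight κ c * ∑ x, ((n : ℝ) ^ 2 * ‖φ n x - ψ n x‖ +
      ‖z x‖ * |((blockPairs c x).card : ℝ) / n ^ 2 - blockFrac κ x|) := by
        refine (norm_sum_le _ _).trans (Finset.sum_le_sum fun c _ => ?_)
        rw [← mul_sub, norm_mul, Complex.norm_real, Real.norm_eq_abs,
          abs_of_nonneg (labelWeight_nonneg hκ c)]
        exact mul_le_mul_of_nonneg_left (hc c) (labelWeight_nonneg hκ c)
    _ = _ := by
        simp only [Finset.mul_sum]
        rw [Finset.sum_comm]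
        refine Finset.sum_congr rfl fun x _ => ?_
        simp only [mul_add, Finset.sum_add_distrib]
        rw [← Finset.sum_mul, sum_labelWeight, one_mul]
        congr 1
        exact Finset.sum_congr rfl fun c _ => by ring

/-! ### The characteristic function of the block sums -/

/-- The connection probabilities of the three blocks. -/
noncomputable def connRate (n : ℕ) (q μ₁ μ₂ : ℝ) : Fin 3 → ℝ := ![q + μ₁ / √n, q + μ₂ / √n, q]

/-- The type II error rates of the three blocks. -/
noncomputable def errRate (n : ℕ) (β γ₁ γ₂ : ℝ) : Fin 3 → ℝ := ![β - γ₁ / √n, β - γ₂ / √n, β]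

lemma connMatrix_apply (n : ℕ) (q μ₁ μ₂ : ℝ) (g h : Fin 2) :
    connMatrix n q μ₁ μ₂ g h = connRate n q μ₁ μ₂ (block g h) := by
  fin_cases g <;> fin_cases h <;> simp [connMatrix, connRate, block]

lemma errMatrix_apply (n : ℕ) (β γ₁ γ₂ : ℝ) (g h : Fin 2) :
    errMatrix n β γ₁ γ₂ g h = errRate n β γ₁ γ₂ (block g h) := by
  fin_cases g <;> fin_cases h <;> simp [errMatrix, errRate, block]

lemma tendsto_const_div_sqrt (a : ℝ) : Tendsto (fun n : ℕ => a / √(n : ℝ)) atTop (𝓝 0) :=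
  tendsto_const_nhds.div_atTop (Real.tendsto_sqrt_atTop.comp tendsto_natCast_atTop_atTop)

lemma tendsto_connRate (q μ₁ μ₂ : ℝ) (x : Fin 3) :
    Tendsto (fun n : ℕ => connRate n q μ₁ μ₂ x) atTop (𝓝 q) := by
  fin_cases x
  · simpa [connRate] using (tendsto_const_div_sqrt μ₁).const_add q
  · simpa [connRate] using (tendsto_const_div_sqrt μ₂).const_add q
  · simp [connRate]

lemma tendsto_errRate (β γ₁ γ₂ : ℝ) (x : Fin 3) :
    Tendsto (fun n : ℕ => errRate n β γ₁ γ₂ x) atTop (𝓝 β) := by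
  fin_cases x
  · simpa [errRate] using (tendsto_const_div_sqrt γ₁).const_sub β
  · simpa [errRate] using (tendsto_const_div_sqrt γ₂).const_sub β
  · simp [errRate]

lemma eventually_connRate_mem {q : ℝ} (hq : q ∈ Set.Ioo (0 : ℝ) 1) (μ₁ μ₂ : ℝ) :
    ∀ᶠ n in atTop, ∀ x, connRate n q μ₁ μ₂ x ∈ Set.Icc (0 : ℝ) 1 :=
  eventually_all.2 fun x => tendsto_connRate q μ₁ μ₂ x (Icc_mem_nhds hq.1 hq.2)

lemma eventually_errRate_mem {β : ℝ} (hβ : β ∈ Set.Ioo (0 : ℝ) 1) (γ₁ γ₂ : ℝ) :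
    ∀ᶠ n in atTop, ∀ x, errRate n β γ₁ γ₂ x ∈ Set.Icc (0 : ℝ) 1 :=
  eventually_all.2 fun x => tendsto_errRate β γ₁ γ₂ x (Icc_mem_nhds hβ.1 hβ.2)

/-- The contribution of a node pair with observed entries `b`, `b'` to the residual of the second
moment after subtraction of `e` times the first moment; it is centred if `e` is the error rate. -/
noncomputable def residual (e : ℝ) (b b' : Bool) : ℝ := |entry b - entry b'| / 2 - e * entry b

/-- The residuals summed over the three blocks, divided by `n`, followed by the numbers of observed
edges in the three blocks, divided by `n²`. -/
noncomputable def blockSums {n : ℕ} (e : Fin 3 → ℝ) (c : Labels n) (y y' : BinMat n) :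
    EuclideanSpace ℝ (Fin 3 ⊕ Fin 3) :=
  WithLp.toLp 2 (Sum.elim
    (fun x => (∑ p ∈ blockPairs c x, residual (e x) (y p.1 p.2) (y' p.1 p.2)) / n)
    (fun x => (∑ p ∈ blockPairs c x, entry (y p.1 p.2)) / n ^ 2))

/-- The contribution of a node pair to the inner product of the block sums with a vector whose
coordinates belonging to the block of the pair are `s` and `u`. -/
noncomputable def phase (n : ℕ) (e s u : ℝ) (b b' : Bool) : ℝ :=
  s * residual e b b' / n + u * entry b / n ^ 2

lemma inner_blockSums {n : ℕ} (e : Fin 3 → ℝ) (c : Labels n) (y y' : BinMat n)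
    (t : EuclideanSpace ℝ (Fin 3 ⊕ Fin 3)) :
    inner ℝ (blockSums e c y y') t = ∑ p ∈ nodePairs n,
      phase n (e (block (c p.1) (c p.2))) (t (.inl (block (c p.1) (c p.2))))
        (t (.inr (block (c p.1) (c p.2)))) (y p.1 p.2) (y' p.1 p.2) := by
  rw [← Finset.sum_fiberwise (nodePairs n) (fun p => block (c p.1) (c p.2))]
  simp only [PiLp.inner_apply, Fintype.sum_sum_type, blockSums, Sum.elim_inl, Sum.elim_inr]
  rw [← Finset.sum_add_distrib]
  refine Finset.sum_congr rfl fun x _ => ?_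
  have : ∀ p ∈ blockPairs c x, phase n (e (block (c p.1) (c p.2)))
      (t (.inl (block (c p.1) (c p.2)))) (t (.inr (block (c p.1) (c p.2)))) (y p.1 p.2) (y' p.1 p.2)
      = phase n (e x) (t (.inl x)) (t (.inr x)) (y p.1 p.2) (y' p.1 p.2) := by
    intro p hp
    rw [(Finset.mem_filter.1 hp).2]
  change _ = ∑ p ∈ blockPairs c x, _
  rw [Finset.sum_congr rfl this]
  simp only [phase, Finset.sum_add_distrib, ← Finset.sum_div, ← Finset.mul_sum]
  simp only [RCLike.inner_apply, conj_trivial]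
  ring

lemma norm_pairExp_le {p e : ℝ} (hp : p ∈ Set.Icc (0 : ℝ) 1) (he : e ∈ Set.Icc (0 : ℝ) 1)
    {h : Bool → Bool → ℂ} (hh : ∀ b b', ‖h b b'‖ ≤ 1) : ‖pairExp p e h‖ ≤ 1 := by
  have h1 : 0 ≤ 1 - e := sub_nonneg.2 he.2
  have h2 : 0 ≤ 1 - p := sub_nonneg.2 hp.2
  have key : ∀ r : ℝ, 0 ≤ r → ∀ b b', ‖(r : ℂ) * h b b'‖ ≤ r := by
    intro r hr b b'
    rw [norm_mul, Complex.norm_real, Real.norm_eq_abs, abs_of_nonneg hr]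
    exact mul_le_of_le_one_right hr (hh b b')
  have hp0 := hp.1
  have he0 := he.1
  rw [pairExp_eq]
  refine (norm_add_le _ _).trans ((add_le_add ((norm_add_le _ _).trans (add_le_add
    ((norm_add_le _ _).trans (add_le_add (key _ (by positivity) _ _) (key _ (by positivity) _ _)))
    (key _ (by positivity) _ _))) (key _ (by positivity) _ _)).trans ?_)
  apply le_of_eq
  ring

lemma integral_exp_inner_blockSums {n : ℕ} {κ q β μ₁ μ₂ γ₁ γ₂ : ℝ}
    (hκ : κ ∈ Set.Icc (0 : ℝ) 1) (hB : ∀ x, connRate n q μ₁ μ₂ x ∈ Set.Icc (0 : ℝ) 1)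
    (hE : ∀ x, errRate n β γ₁ γ₂ x ∈ Set.Icc (0 : ℝ) 1)
    (t : EuclideanSpace ℝ (Fin 3 ⊕ Fin 3)) :
    ∫ x, Complex.exp ((inner ℝ (blockSums (errRate n β γ₁ γ₂) x.1 x.2.2.1 x.2.2.2) t : ℝ) *
        Complex.I) ∂(law n κ (connMatrix n q μ₁ μ₂) (errMatrix n β γ₁ γ₂))
      = ∑ c : Labels n, (labelWeight κ c : ℂ) * ∏ x, pairExp (connRate n q μ₁ μ₂ x)
          (errRate n β γ₁ γ₂ x) (fun b b' => Complex.exp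
            (phase n (errRate n β γ₁ γ₂ x) (t (.inl x)) (t (.inr x)) b b' * Complex.I)) ^
          (blockPairs c x).card := by
  have := integral_law_prod (n := n) hκ (B := connMatrix n q μ₁ μ₂) (E := errMatrix n β γ₁ γ₂)
    (fun g h => by rw [connMatrix_apply]; exact hB _)
    (fun g h => by rw [errMatrix_apply]; exact hE _)
    (fun c p b b' => Complex.exp (phase n (errRate n β γ₁ γ₂ (block (c p.1) (c p.2)))
      (t (.inl (block (c p.1) (c p.2)))) (t (.inr (block (c p.1) (c p.2)))) b b' * Complex.I))
  simp only [← Complex.exp_sum, ← Finset.sum_mul, ← Complex.ofReal_sum, ← inner_blockSums] at this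
  rw [this]
  refine Finset.sum_congr rfl fun c _ => ?_
  congr 1
  rw [← Finset.prod_fiberwise (nodePairs n) (fun p => block (c p.1) (c p.2))]
  refine Finset.prod_congr rfl fun x _ => ?_
  rw [← Finset.prod_const]
  refine Finset.prod_congr rfl fun p hp => ?_
  rw [connMatrix_apply, errMatrix_apply, (Finset.mem_filter.1 hp).2]

/-- Second-order expansion of the characteristic function of one node pair: the residuals are
centred with variance `p (1 - e) e / 2`. -/
lemma tendsto_sq_mul_pairExp_sub_one {p e : ℕ → ℝ} {q β : ℝ} (hp : Tendsto p atTop (𝓝 q))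
    (he : Tendsto e atTop (𝓝 β)) (s u : ℝ) :
    Tendsto (fun n : ℕ => (n : ℂ) ^ 2 * (pairExp (p n) (e n) (fun b b' =>
      Complex.exp (phase n (e n) s u b b' * Complex.I)) - 1)) atTop
      (𝓝 (((-(β * ((1 - β) * q) / 2 * s ^ 2 / 2) : ℝ) : ℂ) +
        ((u * ((1 - β) * q) : ℝ) : ℂ) * Complex.I)) := by
  have hpc : Tendsto (fun n => (p n : ℂ)) atTop (𝓝 (q : ℂ)) :=
    (Complex.continuous_ofReal.tendsto _).comp hp
  have hec : Tendsto (fun n => (e n : ℂ)) atTop (𝓝 (β : ℂ)) :=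
    (Complex.continuous_ofReal.tendsto _).comp he
  -- `n` times a phase with residual `r n` converges.
  have hph : ∀ (r : ℕ → ℝ) (ρ b : ℝ), Tendsto r atTop (𝓝 ρ) → Tendsto (fun n : ℕ => (n : ℂ) *
      (((s * r n / n + u * b / n ^ 2 : ℝ) : ℂ) * Complex.I)) atTop
      (𝓝 (((s * ρ : ℝ) : ℂ) * Complex.I)) := by
    intro r ρ b hr
    have h1 : Tendsto (fun n : ℕ => s * r n + u * b * (n : ℝ)⁻¹) atTop (𝓝 (s * ρ + u * b * 0)) :=
      (hr.const_mul s).add (tendsto_inv_atTop_nhds_zero_nat.const_mul _)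
    rw [mul_zero, add_zero] at h1
    refine (((Complex.continuous_ofReal.tendsto _).comp h1).mul_const Complex.I).congr' ?_
    filter_upwards [eventually_ne_atTop 0] with n hn
    have : (n : ℂ) ≠ 0 := by exact_mod_cast hn
    simp only [Function.comp_apply]
    push_cast
    field_simp
  have l1 := tendsto_sq_mul_exp_sub_one_sub (hph (fun n => -e n) (-β) 1 he.neg)
  have l2 := tendsto_sq_mul_exp_sub_one_sub (hph (fun n => 1 / 2 - e n) (1 / 2 - β) 1
    (he.const_sub _))
  have l3 := tendsto_sq_mul_exp_sub_one_sub (hph (fun _ => 1 / 2) (1 / 2) 0 tendsto_const_nhds)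
  have w1 : Tendsto (fun n => (p n : ℂ) * (1 - e n) ^ 2) atTop (𝓝 ((q : ℂ) * (1 - β) ^ 2)) :=
    hpc.mul ((hec.const_sub 1).pow 2)
  have w2 : Tendsto (fun n => (p n : ℂ) * e n * (1 - e n)) atTop (𝓝 ((q : ℂ) * β * (1 - β))) :=
    (hpc.mul hec).mul (hec.const_sub 1)
  have w3 : Tendsto (fun n => (u : ℂ) * ((1 - e n) * p n) * Complex.I) atTop
      (𝓝 ((u : ℂ) * ((1 - β) * q) * Complex.I)) :=
    (((hec.const_sub 1).mul hpc).const_mul _).mul_const _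
  have hsum := (((w1.mul l1).add (w2.mul l2)).add (w2.mul l3)).add w3
  have hI : Complex.I ^ 2 = -1 := Complex.I_sq
  convert hsum.congr' ?_ using 2
  · push_cast
    simp only [mul_pow, hI]
    ring
  · filter_upwards [eventually_ne_atTop 0] with n hn
    have hn' : (n : ℂ) ≠ 0 := by exact_mod_cast hn
    rw [pairExp_eq]
    have p1 : phase n (e n) s u true true = s * -e n / n + u * 1 / n ^ 2 := by
      simp [phase, residual, entry]
    have p2 : phase n (e n) s u true false = s * (1 / 2 - e n) / n + u * 1 / n ^ 2 := by
      simp [phase, residual, entry]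
    have p3 : phase n (e n) s u false true = s * (1 / 2) / n + u * 0 / n ^ 2 := by
      simp [phase, residual, entry]
    have p4 : phase n (e n) s u false false = 0 := by
      simp [phase, residual, entry]
    rw [p1, p2, p3, p4]
    generalize e1 : Complex.exp (((s * -e n / n + u * 1 / n ^ 2 : ℝ) : ℂ) * Complex.I) = E1
    generalize e2 : Complex.exp (((s * (1 / 2 - e n) / n + u * 1 / n ^ 2 : ℝ) : ℂ) * Complex.I) = E2
    generalize e3 : Complex.exp (((s * (1 / 2) / n + u * 0 / n ^ 2 : ℝ) : ℂ) * Complex.I) = E3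
    push_cast
    simp only [zero_mul, Complex.exp_zero]
    -- The terms linear in `s` cancel because the residuals are centred.
    field_simp
    ring

/-- The limiting mean of the block sums. -/
noncomputable def limitMean (κ q β : ℝ) : EuclideanSpace ℝ (Fin 3 ⊕ Fin 3) :=
  WithLp.toLp 2 (Sum.elim 0 fun x => blockFrac κ x * ((1 - β) * q))

/-- The limiting covariance matrix of the block sums. -/
noncomputable def limitCov (κ q β : ℝ) : Matrix (Fin 3 ⊕ Fin 3) (Fin 3 ⊕ Fin 3) ℝ :=
  Matrix.diagonal (Sum.elim (fun x => blockFrac κ x * (β * ((1 - β) * q) / 2)) 0)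

lemma blockFrac_pos {κ : ℝ} (hκ : κ ∈ Set.Ioo (0 : ℝ) 1) (x : Fin 3) : 0 < blockFrac κ x := by
  have h0 := hκ.1
  have h1 : 0 < 1 - κ := sub_pos.2 hκ.2
  fin_cases x <;> simp [blockFrac] <;> positivity

lemma posSemidef_limitCov {κ q β : ℝ} (hκ : κ ∈ Set.Ioo (0 : ℝ) 1) (hq : q ∈ Set.Ioo (0 : ℝ) 1)
    (hβ : β ∈ Set.Ioo (0 : ℝ) 1) : (limitCov κ q β).PosSemidef := by
  refine Matrix.PosSemidef.diagonal fun x => ?_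
  have h1 : 0 < 1 - β := sub_pos.2 hβ.2
  have := hq.1
  have := hβ.1
  rcases x with x | x
  · have := blockFrac_pos hκ x
    simp only [Pi.zero_apply, Sum.elim_inl]
    positivity
  · simp

/-- Central limit theorem for the residual sums, jointly with the law of large numbers for the
edge counts, at the level of characteristic functions. -/
lemma tendsto_integral_exp_inner_blockSums {κ q β : ℝ} (μ₁ μ₂ γ₁ γ₂ : ℝ)
    (hκ : κ ∈ Set.Ioo (0 : ℝ) 1) (hq : q ∈ Set.Ioo (0 : ℝ) 1) (hβ : β ∈ Set.Ioo (0 : ℝ) 1)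
    (t : EuclideanSpace ℝ (Fin 3 ⊕ Fin 3)) :
    Tendsto (fun n : ℕ => ∫ x, Complex.exp
        ((inner ℝ (blockSums (errRate n β γ₁ γ₂) x.1 x.2.2.1 x.2.2.2) t : ℝ) * Complex.I)
          ∂(law n κ (connMatrix n q μ₁ μ₂) (errMatrix n β γ₁ γ₂))) atTop
      (𝓝 (charFun (multivariateGaussian (limitMean κ q β) (limitCov κ q β)) t)) := by
  have h1 : 0 < 1 - β := sub_pos.2 hβ.2
  have hq0 := hq.1
  have hβ0 := hβ.1
  have hκ' := Set.Ioo_subset_Icc_self hκ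
  have main := tendsto_sum_labelWeight_prod_pow hκ'
    (φ := fun n x => pairExp (connRate n q μ₁ μ₂ x) (errRate n β γ₁ γ₂ x) (fun b b' =>
      Complex.exp (phase n (errRate n β γ₁ γ₂ x) (t (.inl x)) (t (.inr x)) b b' * Complex.I)))
    (z := fun x => ((-(β * ((1 - β) * q) / 2 * t (.inl x) ^ 2 / 2) : ℝ) : ℂ) +
        ((t (.inr x) * ((1 - β) * q) : ℝ) : ℂ) * Complex.I)
    (by
      filter_upwards [eventually_connRate_mem hq μ₁ μ₂, eventually_errRate_mem hβ γ₁ γ₂]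
        with n hB hE x
      exact norm_pairExp_le (hB x) (hE x) fun b b' => (Complex.norm_exp_ofReal_mul_I _).le)
    (fun x => by
      rw [Complex.add_re, Complex.ofReal_re, Complex.re_ofReal_mul, Complex.I_re, mul_zero,
        add_zero, neg_nonpos]
      positivity)
    (fun x => tendsto_sq_mul_pairExp_sub_one (tendsto_connRate q μ₁ μ₂ x)
      (tendsto_errRate β γ₁ γ₂ x) _ _)
  convert main.congr' ?_ using 2
  · rw [charFun_multivariateGaussian (posSemidef_limitCov hκ hq hβ), ← Complex.exp_sum]
    congr 1
    simp only [PiLp.inner_apply, Fintype.sum_sum_type, limitMean, limitCov, Sum.elim_inl,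
      Sum.elim_inr, dotProduct, Matrix.mulVec_diagonal, RCLike.inner_apply, conj_trivial,
      Pi.zero_apply, zero_mul, mul_zero, Finset.sum_const_zero, zero_add, add_zero,
      Complex.ofReal_sum, Finset.sum_mul, Finset.sum_div]
    rw [← Finset.sum_sub_distrib]
    refine Finset.sum_congr rfl fun x _ => ?_
    push_cast
    ring
  · filter_upwards [eventually_connRate_mem hq μ₁ μ₂, eventually_errRate_mem hβ γ₁ γ₂]
      with n hB hE
    exact (integral_exp_inner_blockSums hκ' hB hE t).symm

/-! ### The covariance matrix of the limit -/

/-- The linear map `(z₀, z₁, z₂) ↦ (z₂, z₂ - z₀, z₂ - z₁)`, which takes the normalised errors of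
`β̂₁`, `β̂₂`, `β̂_b` to the pivot. -/
def contrast (z : Fin 3 → ℝ) : EuclideanSpace ℝ (Fin 3) := !₂[z 2, z 2 - z 0, z 2 - z 1]

/-- The adjoint of `contrast`. -/
def contrastAdj (t : Fin 3 → ℝ) : Fin 3 → ℝ := ![-t 1, -t 2, t 0 + t 1 + t 2]

lemma inner_contrast (z : Fin 3 → ℝ) (t : EuclideanSpace ℝ (Fin 3)) :
    inner ℝ (contrast z) t = ∑ x, z x * contrastAdj t x := by
  simp [contrast, contrastAdj, PiLp.inner_apply, Fin.sum_univ_three]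
  ring

lemma sigmaBeta_eq {κ q β : ℝ} (hκ : κ ∈ Set.Ioo (0 : ℝ) 1) (hq : q ∈ Set.Ioo (0 : ℝ) 1)
    (hβ : β ∈ Set.Ioo (0 : ℝ) 1) :
    sigmaBeta κ q β = (β / (2 * ((1 - β) * q))) •
      !![(blockFrac κ 2)⁻¹, (blockFrac κ 2)⁻¹, (blockFrac κ 2)⁻¹;
        (blockFrac κ 2)⁻¹, (blockFrac κ 2)⁻¹ + (blockFrac κ 0)⁻¹, (blockFrac κ 2)⁻¹;
        (blockFrac κ 2)⁻¹, (blockFrac κ 2)⁻¹, (blockFrac κ 2)⁻¹ + (blockFrac κ 1)⁻¹] := by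
  have h1 : 1 - β ≠ 0 := (sub_pos.2 hβ.2).ne'
  have h2 : 1 - κ ≠ 0 := (sub_pos.2 hκ.2).ne'
  have h3 := hκ.1.ne'
  have h4 := hq.1.ne'
  ext i j
  simp only [sigmaBeta, Matrix.mul_apply, Matrix.transpose_apply, Fin.sum_univ_six]
  fin_cases i <;> fin_cases j <;>
    simp [jacobian, momentCov, sigmaU, blockFrac] <;> field_simp <;> ring

/-- The quadratic form of `Σ_β` is diagonal in the coordinates `contrastAdj t`. -/
lemma quadForm_sigmaBeta {κ q β : ℝ} (hκ : κ ∈ Set.Ioo (0 : ℝ) 1) (hq : q ∈ Set.Ioo (0 : ℝ) 1)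
    (hβ : β ∈ Set.Ioo (0 : ℝ) 1) (t : Fin 3 → ℝ) :
    t ⬝ᵥ (sigmaBeta κ q β).mulVec t =
      ∑ x, β / (2 * ((1 - β) * q)) * (blockFrac κ x)⁻¹ * contrastAdj t x ^ 2 := by
  rw [sigmaBeta_eq hκ hq hβ]
  simp [dotProduct, Matrix.mulVec, Fin.sum_univ_three, contrastAdj]
  ring

lemma posDef_sigmaBeta {κ q β : ℝ} (hκ : κ ∈ Set.Ioo (0 : ℝ) 1) (hq : q ∈ Set.Ioo (0 : ℝ) 1)
    (hβ : β ∈ Set.Ioo (0 : ℝ) 1) : (sigmaBeta κ q β).PosDef := by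
  refine Matrix.posDef_iff_dotProduct_mulVec.2 ⟨?_, fun t ht => ?_⟩
  · rw [sigmaBeta_eq hκ hq hβ]
    ext i j
    fin_cases i <;> fin_cases j <;> simp
  · rw [star_trivial, quadForm_sigmaBeta hκ hq hβ]
    have h1 : 0 < 1 - β := sub_pos.2 hβ.2
    have hq0 := hq.1
    have hβ0 := hβ.1
    have hpos : ∀ x, 0 < β / (2 * ((1 - β) * q)) * (blockFrac κ x)⁻¹ := fun x => by
      have := blockFrac_pos hκ x
      positivity
    obtain ⟨x, hx⟩ : ∃ x, contrastAdj t x ≠ 0 := by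
      by_contra! h
      apply ht
      have e1 : t 1 = 0 := by simpa [contrastAdj] using h 0
      have e2 : t 2 = 0 := by simpa [contrastAdj] using h 1
      have e0 : t 0 = 0 := by simpa [contrastAdj, e1, e2] using h 2
      ext i
      fin_cases i <;> simp [e0, e1, e2]
    refine Finset.sum_pos' (fun y _ => mul_nonneg (hpos y).le (sq_nonneg _))
      ⟨x, Finset.mem_univ _, mul_pos (hpos x) (by positivity)⟩

/-! ### The limit law as an image of the limit of the block sums -/

/-- The pivot as a function of the block sums, with the denominators bounded below by half of
their limits in order to make it continuous. -/
noncomputable def truncatedPivot (m : Fin 3 → ℝ) (v : EuclideanSpace ℝ (Fin 3 ⊕ Fin 3)) :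
    EuclideanSpace ℝ (Fin 3) :=
  contrast fun x => v (.inl x) / max (v (.inr x)) (m x / 2)

lemma continuous_contrast : Continuous contrast := by
  unfold contrast
  fun_prop

lemma continuous_truncatedPivot {m : Fin 3 → ℝ} (hm : ∀ x, 0 < m x) :
    Continuous (truncatedPivot m) := by
  refine continuous_contrast.comp (continuous_pi fun x => ?_)
  refine Continuous.div (by fun_prop) (by fun_prop) fun v => ?_
  exact ((half_pos (hm x)).trans_le (le_max_right _ _)).ne'

lemma ae_limit_apply_inr {κ q β : ℝ} (hκ : κ ∈ Set.Ioo (0 : ℝ) 1) (hq : q ∈ Set.Ioo (0 : ℝ) 1)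
    (hβ : β ∈ Set.Ioo (0 : ℝ) 1) (x : Fin 3) :
    ∀ᵐ v ∂(multivariateGaussian (limitMean κ q β) (limitCov κ q β)),
      v (.inr x) = blockFrac κ x * ((1 - β) * q) := by
  have h := measurePreserving_eval_multivariateGaussian (μ := limitMean κ q β)
    (posSemidef_limitCov hκ hq hβ) (i := .inr x)
  have h0 : (limitCov κ q β (.inr x) (.inr x)).toNNReal = 0 := by simp [limitCov]
  rw [h0, gaussianReal_zero_var] at h
  have := h.quasiMeasurePreserving.ae
    (p := fun r => r = blockFrac κ x * ((1 - β) * q)) (by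
      rw [ae_dirac_eq]; simp [limitMean])
  exact this

/-- The denominators are constant under the limit law of the block sums, so the truncated pivot
acts on it as a linear map and its image is Gaussian. -/
lemma map_truncatedPivot {κ q β : ℝ} (hκ : κ ∈ Set.Ioo (0 : ℝ) 1) (hq : q ∈ Set.Ioo (0 : ℝ) 1)
    (hβ : β ∈ Set.Ioo (0 : ℝ) 1) :
    (multivariateGaussian (limitMean κ q β) (limitCov κ q β)).map
      (truncatedPivot fun x => blockFrac κ x * ((1 - β) * q))
      = multivariateGaussian 0 (sigmaBeta κ q β) := by
  have h1 : 0 < 1 - β := sub_pos.2 hβ.2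
  have hq0 := hq.1
  have hf := blockFrac_pos hκ
  set m : Fin 3 → ℝ := fun x => blockFrac κ x * ((1 - β) * q) with hm
  have hmpos : ∀ x, 0 < m x := fun x => mul_pos (hf x) (mul_pos h1 hq0)
  have hcont := continuous_truncatedPivot hmpos
  have : IsProbabilityMeasure ((multivariateGaussian (limitMean κ q β) (limitCov κ q β)).map
      (truncatedPivot m)) := Measure.isProbabilityMeasure_map hcont.aemeasurable
  apply Measure.ext_of_charFun
  ext t
  let s : EuclideanSpace ℝ (Fin 3 ⊕ Fin 3) :=
    WithLp.toLp 2 (Sum.elim (fun x => contrastAdj t x / m x) 0)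
  have e1 : charFun ((multivariateGaussian (limitMean κ q β) (limitCov κ q β)).map
      (truncatedPivot m)) t
      = charFun (multivariateGaussian (limitMean κ q β) (limitCov κ q β)) s := by
    rw [charFun_apply, charFun_apply, integral_map hcont.aemeasurable
      (by fun_prop)]
    refine integral_congr_ae ?_
    filter_upwards [ae_all_iff.2 (ae_limit_apply_inr hκ hq hβ)] with v hv
    congr 3
    rw [truncatedPivot, inner_contrast]
    simp only [PiLp.inner_apply, Fintype.sum_sum_type, s, Sum.elim_inl, Sum.elim_inr,
      RCLike.inner_apply, conj_trivial, Pi.zero_apply, zero_mul, Finset.sum_const_zero, add_zero]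
    refine Finset.sum_congr rfl fun x _ => ?_
    rw [hv x, max_eq_left (half_le_self (hmpos x).le)]
    ring
  rw [e1, charFun_multivariateGaussian (posSemidef_limitCov hκ hq hβ),
    charFun_multivariateGaussian (posDef_sigmaBeta hκ hq hβ).posSemidef, quadForm_sigmaBeta hκ hq hβ]
  congr 1
  have e2 : inner ℝ s (limitMean κ q β) = 0 := by
    simp [PiLp.inner_apply, s, limitMean]
  rw [e2, inner_zero_right]
  congr 3
  simp only [dotProduct, limitCov, Matrix.mulVec_diagonal, Fintype.sum_sum_type, s, Sum.elim_inl,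
    Sum.elim_inr, Pi.zero_apply, zero_mul, Finset.sum_const_zero, add_zero]
  refine Finset.sum_congr rfl fun x _ => ?_
  have := hf x
  simp only [hm]
  field_simp

/-! ### Convergence in distribution on varying probability spaces -/

section Convergence

variable {Ω : ℕ → Type*} [∀ n, MeasurableSpace (Ω n)] {P : (n : ℕ) → Measure (Ω n)}
  [∀ n, IsProbabilityMeasure (P n)]

/-- Modifying random variables on events of vanishing probability does not change a limit in
distribution. -/
lemma tendstoInDistribution_of_tendsto_measure_ne {E Ω' : Type*} [TopologicalSpace E]
    [MeasurableSpace E] [BorelSpace E] {mΩ' : MeasurableSpace Ω'} {P' : Measure Ω'}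
    [IsProbabilityMeasure P'] {X X' : (n : ℕ) → Ω n → E} {Z : Ω' → E}
    (h : TendstoInDistribution X atTop Z P P') (hX' : ∀ n, AEMeasurable (X' n) (P n))
    {B : (n : ℕ) → Set (Ω n)} (hB : ∀ n, MeasurableSet (B n))
    (hne : ∀ n, ∀ ω ∉ B n, X n ω = X' n ω)
    (hlim : Tendsto (fun n => (P n).real (B n)) atTop (𝓝 0)) :
    TendstoInDistribution X' atTop Z P P' := by
  refine ⟨hX', h.aemeasurable_limit, ?_⟩
  have h1 := ProbabilityMeasure.tendsto_iff_forall_integral_tendsto.1 h.tendsto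
  refine ProbabilityMeasure.tendsto_iff_forall_integral_tendsto.2 fun f => ?_
  have h1f := h1 f
  simp only [ProbabilityMeasure.coe_mk] at h1f ⊢
  have hdiff : Tendsto (fun n => ∫ x, f x ∂((P n).map (X' n)) - ∫ x, f x ∂((P n).map (X n))) atTop
      (𝓝 0) := by
    have hb : Tendsto (fun n => 2 * ‖f‖ * (P n).real (B n)) atTop (𝓝 0) := by
      simpa using hlim.const_mul (2 * ‖f‖)
    refine squeeze_zero_norm (fun n => ?_) hb
    have hmX := h.forall_aemeasurable n
    rw [integral_map (hX' n) (by fun_prop), integral_map hmX (by fun_prop)]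
    have hi : ∀ {W : Ω n → E}, AEMeasurable W (P n) → Integrable (fun ω => f (W ω)) (P n) :=
      fun hW => Integrable.of_bound (f.continuous.measurable.comp_aemeasurable
        hW).aestronglyMeasurable ‖f‖ (Eventually.of_forall fun ω => f.norm_coe_le_norm _)
    rw [← integral_sub (hi (hX' n)) (hi hmX)]
    calc ‖∫ ω, f (X' n ω) - f (X n ω) ∂(P n)‖
        ≤ ∫ ω, (B n).indicator (fun _ => 2 * ‖f‖) ω ∂(P n) := by
          refine norm_integral_le_of_norm_le ((integrable_const _).indicator (hB n))
            (Eventually.of_forall fun ω => ?_)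
          by_cases hω : ω ∈ B n
          · rw [Set.indicator_of_mem hω, ← dist_eq_norm]
            exact f.dist_le_two_norm _ _
          · simp [hω, hne n ω hω]
      _ = 2 * ‖f‖ * (P n).real (B n) := by
          rw [integral_indicator (hB n), setIntegral_const, smul_eq_mul, mul_comm]
  simpa using hdiff.add h1f

/-- Conditioning on events of probability tending to one does not change a weak limit. -/
lemma tendsto_integral_cond {E : Type*} [TopologicalSpace E] [MeasurableSpace E] [BorelSpace E]
    {X : (n : ℕ) → Ω n → E} (hX : ∀ n, Measurable (X n)) {s : (n : ℕ) → Set (Ω n)}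
    (hs : ∀ n, MeasurableSet (s n)) (hlim : Tendsto (fun n => (P n).real (s n)ᶜ) atTop (𝓝 0))
    (f : E →ᵇ ℝ) {a : ℝ} (ha : Tendsto (fun n => ∫ ω, f (X n ω) ∂(P n)) atTop (𝓝 a)) :
    Tendsto (fun n => ∫ ω, f (X n ω) ∂(cond (P n) (s n))) atTop (𝓝 a) := by
  have hcompl : Tendsto (fun n => ∫ ω in (s n)ᶜ, f (X n ω) ∂(P n)) atTop (𝓝 0) := by
    have hb : Tendsto (fun n => ‖f‖ * (P n).real (s n)ᶜ) atTop (𝓝 0) := by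
      simpa using hlim.const_mul ‖f‖
    refine squeeze_zero_norm (fun n => ?_) hb
    exact norm_setIntegral_le_of_norm_le_const (measure_lt_top _ _)
      fun ω _ => f.norm_coe_le_norm _
  have hs1 : Tendsto (fun n => (P n).real (s n)) atTop (𝓝 1) := by
    have := hlim.const_sub 1
    rw [sub_zero] at this
    refine this.congr fun n => ?_
    rw [probReal_compl_eq_one_sub (hs n)]; ring
  have := (hs1.inv₀ one_ne_zero).mul (ha.sub hcompl)
  rw [inv_one, one_mul, sub_zero] at this
  refine this.congr fun n => ?_
  have hi : Integrable (fun ω => f (X n ω)) (P n) :=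
    Integrable.of_bound (f.continuous.measurable.comp (hX n)).aestronglyMeasurable ‖f‖
      (Eventually.of_forall fun ω => f.norm_coe_le_norm _)
  rw [ProbabilityTheory.cond, integral_smul_measure, ← integral_add_compl (hs n) hi, add_sub_cancel_right,
    smul_eq_mul, ENNReal.toReal_inv]
  rfl

end Convergence

/-! ### The pivot in terms of the block sums -/

/-- The normalisation `N` cancels in the ratio of the moments, and centring the ratio at `e` turns
its numerator into a sum of residuals. -/
lemma mul_moment_ratio_sub {n : ℕ} {N : ℝ} {S : Finset (Fin n × Fin n)} (hN : (S.card : ℝ) = N)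
    (hn : (n : ℝ) ≠ 0) (y y' : BinMat n) (hy : ∑ p ∈ S, entry (y p.1 p.2) ≠ 0) (e : ℝ) :
    (n : ℝ) * (moment₂ N S y y' / moment₁ N S y - e)
      = ((∑ p ∈ S, residual e (y p.1 p.2) (y' p.1 p.2)) / n)
        / ((∑ p ∈ S, entry (y p.1 p.2)) / n ^ 2) := by
  have hN0 : N ≠ 0 := by
    rintro rfl
    have : S = ∅ := Finset.card_eq_zero.1 (by exact_mod_cast hN)
    simp [this] at hy
  simp only [residual, Finset.sum_sub_distrib, ← Finset.mul_sum, ← Finset.sum_div, moment₁, moment₂]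
  field_simp

lemma pivot_eq_truncatedPivot {n : ℕ} (hn : 0 < n) {β γ₁ γ₂ : ℝ} {m : Fin 3 → ℝ}
    (hm : ∀ x, 0 < m x) (c : Labels n) (y y' : BinMat n)
    (h : ∀ x, m x / 2 < blockSums (errRate n β γ₁ γ₂) c y y' (.inr x)) :
    pivot β γ₁ γ₂ c y y' = truncatedPivot m (blockSums (errRate n β γ₁ γ₂) c y y') := by
  have hn0 : (n : ℝ) ≠ 0 := by exact_mod_cast hn.ne'
  have hs : √(n : ℝ) ≠ 0 := (Real.sqrt_pos.2 (by exact_mod_cast hn)).ne'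
  have hsq : √(n : ℝ) * √(n : ℝ) = n := Real.mul_self_sqrt (Nat.cast_nonneg n)
  have hy : ∀ x, ∑ p ∈ blockPairs c x, entry (y p.1 p.2) ≠ 0 := by
    intro x h0
    have := (half_pos (hm x)).trans (h x)
    simp [blockSums, h0] at this
  have hz : ∀ x, blockSums (errRate n β γ₁ γ₂) c y y' (.inl x) /
      max (blockSums (errRate n β γ₁ γ₂) c y y' (.inr x)) (m x / 2) =
      ((∑ p ∈ blockPairs c x, residual (errRate n β γ₁ γ₂ x) (y p.1 p.2) (y' p.1 p.2)) / n)
        / ((∑ p ∈ blockPairs c x, entry (y p.1 p.2)) / n ^ 2) := by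
    intro x
    rw [max_eq_left (h x).le]
    rfl
  have z0 := mul_moment_ratio_sub (card_withinPairs c 0) hn0 y y'
    (by rw [withinPairs_zero]; exact hy 0) (errRate n β γ₁ γ₂ 0)
  have z1 := mul_moment_ratio_sub (card_withinPairs c 1) hn0 y y'
    (by rw [withinPairs_one]; exact hy 1) (errRate n β γ₁ γ₂ 1)
  have z2 := mul_moment_ratio_sub (card_betweenPairs c) hn0 y y'
    (by rw [betweenPairs_eq]; exact hy 2) (errRate n β γ₁ γ₂ 2)
  have e0 : errRate n β γ₁ γ₂ 0 = β - γ₁ / √n := rfl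
  have e1 : errRate n β γ₁ γ₂ 1 = β - γ₂ / √n := rfl
  have e2 : errRate n β γ₁ γ₂ 2 = β := rfl
  simp only [truncatedPivot, contrast, hz]
  rw [← betweenPairs_eq, ← withinPairs_zero, ← withinPairs_one, ← z0, ← z1, ← z2, e0, e1, e2]
  -- `n * (γ / √n) = √n * γ` matches the scaling of the local alternatives.
  have hg : ∀ g : ℝ, (n : ℝ) * (g / √n) = √n * g := by
    intro g; rw [mul_div_assoc', div_eq_iff hs]; linear_combination -g * hsq
  unfold pivot gammaHat
  ext i
  fin_cases i
  · rfl
  · change √(n : ℝ) * (√n * (betaHatBetween c y y' - betaHat c 0 y y') - γ₁)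
      = n * (betaHatBetween c y y' - β) - n * (betaHat c 0 y y' - (β - γ₁ / √n))
    linear_combination (betaHatBetween c y y' - betaHat c 0 y y') * hsq + hg γ₁
  · change √(n : ℝ) * (√n * (betaHatBetween c y y' - betaHat c 1 y y') - γ₂)
      = n * (betaHatBetween c y y' - β) - n * (betaHat c 1 y y' - (β - γ₂ / √n))
    linear_combination (betaHatBetween c y y' - betaHat c 1 y y') * hsq + hg γ₂

/-! ### The probability that the two replicates coincide -/

lemma card_nodePairs (n : ℕ) : ((nodePairs n).card : ℝ) = n * (n - 1) / 2 := by
  have h := sum_univ_eq_diag_add_nodePairs (n := n) (fun _ _ => 1) (fun _ _ => rfl)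
  simp at h
  linarith

/-- On the support of the model the replicates coincide as soon as they agree above the diagonal. -/
lemma massFun_mul_ite_eq {n : ℕ} {κ : ℝ} {B E : Matrix (Fin 2) (Fin 2) ℝ}
    (x : Labels n × BinMat n × BinMat n × BinMat n) :
    (massFun n κ B E x : ℂ) * (if x.2.2.1 = x.2.2.2 then 1 else 0)
      = massFun n κ B E x * ∏ p ∈ nodePairs n,
        (if x.2.2.1 p.1 p.2 = x.2.2.2 p.1 p.2 then 1 else 0) := by
  by_cases hadj : IsAdjacency x.2.1 ∧ IsAdjacency x.2.2.1 ∧ IsAdjacency x.2.2.2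
  · congr 1
    obtain ⟨_, hy, hy'⟩ := hadj
    rw [Finset.prod_ite_zero, Finset.prod_const_one]
    congr 1
    rw [eq_iff_iff]
    refine ⟨fun h p _ => by rw [h], fun h => ?_⟩
    ext i j
    have key : ∀ i j, i < j → x.2.2.1 i j = x.2.2.2 i j := fun i j hij =>
      h (i, j) (by simpa [nodePairs] using hij)
    rcases lt_trichotomy i j with hij | hij | hij
    · exact key i j hij
    · rw [hij, hy.1, hy'.1]
    · rw [hy.2, hy'.2]; exact key j i hij
  · simp [massFun, hadj]

lemma norm_integral_ite_eq_le {n : ℕ} {κ q β μ₁ μ₂ γ₁ γ₂ r : ℝ}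
    (hκ : κ ∈ Set.Icc (0 : ℝ) 1) (hB : ∀ x, connRate n q μ₁ μ₂ x ∈ Set.Icc (0 : ℝ) 1)
    (hE : ∀ x, errRate n β γ₁ γ₂ x ∈ Set.Icc (0 : ℝ) 1)
    (hr : ∀ x, 1 - 2 * (connRate n q μ₁ μ₂ x * errRate n β γ₁ γ₂ x * (1 - errRate n β γ₁ γ₂ x)) ≤ r) :
    ‖∫ x, (if x.2.2.1 = x.2.2.2 then (1 : ℂ) else 0)
      ∂(law n κ (connMatrix n q μ₁ μ₂) (errMatrix n β γ₁ γ₂))‖ ≤ r ^ (nodePairs n).card := by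
  have hB' : ∀ g h, connMatrix n q μ₁ μ₂ g h ∈ Set.Icc (0 : ℝ) 1 :=
    fun g h => by rw [connMatrix_apply]; exact hB _
  have hE' : ∀ g h, errMatrix n β γ₁ γ₂ g h ∈ Set.Icc (0 : ℝ) 1 :=
    fun g h => by rw [errMatrix_apply]; exact hE _
  have h1 := integral_law_prod (n := n) hκ hB' hE'
    (fun _ _ b b' => if b = b' then 1 else 0)
  rw [integral_law hκ hB' hE'] at h1 ⊢
  simp only [massFun_mul_ite_eq]
  rw [h1]
  calc _ ≤ ∑ c : Labels n, labelWeight κ c * r ^ (nodePairs n).card := by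
        refine (norm_sum_le _ _).trans (Finset.sum_le_sum fun c _ => ?_)
        rw [norm_mul, Complex.norm_real, Real.norm_eq_abs,
          abs_of_nonneg (labelWeight_nonneg hκ c), norm_prod]
        refine mul_le_mul_of_nonneg_left ?_ (labelWeight_nonneg hκ c)
        refine (Finset.prod_le_prod (fun _ _ => norm_nonneg _) fun p _ => ?_).trans_eq
          (Finset.prod_const r)
        have hx := hr (block (c p.1) (c p.2))
        rw [← connMatrix_apply, ← errMatrix_apply] at hx
        have hp := hB' (c p.1) (c p.2)
        have he := hE' (c p.1) (c p.2)
        generalize connMatrix n q μ₁ μ₂ (c p.1) (c p.2) = a at *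
        generalize errMatrix n β γ₁ γ₂ (c p.1) (c p.2) = e at *
        have e1 : pairExp a e (fun b b' => if b = b' then 1 else 0)
            = ((1 - 2 * (a * e * (1 - e)) : ℝ) : ℂ) := by
          rw [pairExp_eq]; push_cast; simp; ring
        rw [e1, Complex.norm_real, Real.norm_eq_abs, abs_of_nonneg]
        · exact hx
        · have h2 : e * (1 - e) ≤ 1 / 4 := by nlinarith [sq_nonneg (e - 1 / 2)]
          have h3 : a * (e * (1 - e)) ≤ 1 * (1 / 4) :=
            mul_le_mul hp.2 h2 (mul_nonneg he.1 (by linarith [he.2])) zero_le_one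
          linarith [mul_assoc a e (1 - e)]
    _ = r ^ (nodePairs n).card := by rw [← Finset.sum_mul, sum_labelWeight, one_mul]

section Model

variable {κ q β μ₁ μ₂ γ₁ γ₂ : ℝ} {Ω : ℕ → Type*} [∀ n, MeasurableSpace (Ω n)]
  {P : (n : ℕ) → Measure (Ω n)} {c : (n : ℕ) → Ω n → Labels n} {A Y Ystar : (n : ℕ) → Ω n → BinMat n}

lemma measurable_comp_model {E : Type*} [MeasurableSpace E] {n : ℕ}
    {c : Ω n → Labels n} {y y' : Ω n → BinMat n}
    (hc : Measurable c) (hy : Measurable y) (hy' : Measurable y')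
    (g : Labels n → BinMat n → BinMat n → E) : Measurable fun ω => g (c ω) (y ω) (y' ω) :=
  (Measurable.of_discrete (f := fun x : Labels n × BinMat n × BinMat n => g x.1 x.2.1 x.2.2)).comp
    (hc.prodMk (hy.prodMk hy'))

lemma tendsto_measureReal_replicates_eq (hκ : κ ∈ Set.Ioo (0 : ℝ) 1) (hq : q ∈ Set.Ioo (0 : ℝ) 1)
    (hβ : β ∈ Set.Ioo (0 : ℝ) 1)
    (hY : ∀ n, Measurable (Y n)) (hYstar : ∀ n, Measurable (Ystar n))
    (hlaw : ∀ᶠ n in atTop, HasLaw (fun ω => (c n ω, A n ω, Y n ω, Ystar n ω))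
      (law n κ (connMatrix n q μ₁ μ₂) (errMatrix n β γ₁ γ₂)) (P n)) :
    Tendsto (fun n => (P n).real {ω | Y n ω = Ystar n ω}) atTop (𝓝 0) := by
  have hpos : 0 < q * β * (1 - β) := mul_pos (mul_pos hq.1 hβ.1) (sub_pos.2 hβ.2)
  have h4 : q * β * (1 - β) < 1 := by
    have : q * β < 1 := mul_lt_one_of_nonneg_of_lt_one_left hq.1.le hq.2 hβ.2.le
    exact mul_lt_one_of_nonneg_of_lt_one_left (mul_nonneg hq.1.le hβ.1.le) this
      (by linarith [hβ.1])
  have hrate : ∀ᶠ n in atTop, ∀ x, 1 - 2 * (connRate n q μ₁ μ₂ x * errRate n β γ₁ γ₂ x *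
      (1 - errRate n β γ₁ γ₂ x)) ≤ 1 - q * β * (1 - β) := by
    refine eventually_all.2 fun x => ?_
    have := ((((tendsto_connRate q μ₁ μ₂ x).mul (tendsto_errRate β γ₁ γ₂ x)).mul
      ((tendsto_errRate β γ₁ γ₂ x).const_sub 1)).const_mul 2).const_sub 1
    exact (this.eventually_lt_const (by linarith)).mono fun n hn => hn.le
  have hcard : Tendsto (fun n => (nodePairs n).card) atTop atTop := by
    refine tendsto_atTop_mono' _ ?_ (tendsto_id)
    filter_upwards [eventually_ge_atTop 3] with n hn
    have h3 : (3 : ℝ) ≤ n := by exact_mod_cast hn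
    have : (n : ℝ) ≤ (nodePairs n).card := by rw [card_nodePairs]; nlinarith
    exact_mod_cast this
  have hpow := (tendsto_pow_atTop_nhds_zero_of_lt_one (r := 1 - q * β * (1 - β))
    (by linarith) (by linarith)).comp hcard
  refine squeeze_zero' (Eventually.of_forall fun n => measureReal_nonneg) ?_ hpow
  filter_upwards [hlaw, hrate, eventually_connRate_mem hq μ₁ μ₂, eventually_errRate_mem hβ γ₁ γ₂]
    with n hl hr hB hE
  have h1 := norm_integral_ite_eq_le (Set.Ioo_subset_Icc_self hκ) hB hE hr
  rw [← hl.integral_comp (Measurable.of_discrete).aestronglyMeasurable] at h1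
  refine le_trans (le_of_eq ?_) h1
  have hs : MeasurableSet {ω | Y n ω = Ystar n ω} := measurableSet_eq_fun (hY n) (hYstar n)
  have : (fun x : Labels n × BinMat n × BinMat n × BinMat n =>
      if x.2.2.1 = x.2.2.2 then (1 : ℂ) else 0) ∘
      (fun ω => (c n ω, A n ω, Y n ω, Ystar n ω))
      = {ω | Y n ω = Ystar n ω}.indicator fun _ => 1 := by
    ext ω
    simp [Set.indicator_apply]
  rw [this, integral_indicator hs, setIntegral_const]
  simp [abs_of_nonneg]

/-! ### Convergence in distribution of the pivot -/

variable [∀ n, IsProbabilityMeasure (P n)]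

lemma tendstoInDistribution_blockSums (hκ : κ ∈ Set.Ioo (0 : ℝ) 1) (hq : q ∈ Set.Ioo (0 : ℝ) 1)
    (hβ : β ∈ Set.Ioo (0 : ℝ) 1) (hc : ∀ n, Measurable (c n))
    (hY : ∀ n, Measurable (Y n)) (hYstar : ∀ n, Measurable (Ystar n))
    (hlaw : ∀ᶠ n in atTop, HasLaw (fun ω => (c n ω, A n ω, Y n ω, Ystar n ω))
      (law n κ (connMatrix n q μ₁ μ₂) (errMatrix n β γ₁ γ₂)) (P n)) :
    TendstoInDistribution
      (fun n ω => blockSums (errRate n β γ₁ γ₂) (c n ω) (Y n ω) (Ystar n ω)) atTop id P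
      (multivariateGaussian (limitMean κ q β) (limitCov κ q β)) := by
  have hmeas : ∀ n, Measurable
      (fun ω => blockSums (errRate n β γ₁ γ₂) (c n ω) (Y n ω) (Ystar n ω)) :=
    fun n => measurable_comp_model (hc n) (hY n) (hYstar n) _
  refine ⟨fun n => (hmeas n).aemeasurable, aemeasurable_id, ?_⟩
  refine ProbabilityMeasure.tendsto_iff_tendsto_charFun.2 fun t => ?_
  simp only [ProbabilityMeasure.coe_mk, Measure.map_id]
  refine (tendsto_integral_exp_inner_blockSums μ₁ μ₂ γ₁ γ₂ hκ hq hβ t).congr' ?_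
  filter_upwards [hlaw] with n hl
  rw [charFun_apply, integral_map (hmeas n).aemeasurable (by fun_prop),
    ← hl.integral_comp (Measurable.of_discrete).aestronglyMeasurable]
  rfl

lemma tendstoInDistribution_pivot (hκ : κ ∈ Set.Ioo (0 : ℝ) 1) (hq : q ∈ Set.Ioo (0 : ℝ) 1)
    (hβ : β ∈ Set.Ioo (0 : ℝ) 1) (hc : ∀ n, Measurable (c n))
    (hY : ∀ n, Measurable (Y n)) (hYstar : ∀ n, Measurable (Ystar n))
    (hlaw : ∀ᶠ n in atTop, HasLaw (fun ω => (c n ω, A n ω, Y n ω, Ystar n ω))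
      (law n κ (connMatrix n q μ₁ μ₂) (errMatrix n β γ₁ γ₂)) (P n)) :
    TendstoInDistribution (fun n ω => pivot β γ₁ γ₂ (c n ω) (Y n ω) (Ystar n ω)) atTop
      id P (multivariateGaussian 0 (sigmaBeta κ q β)) := by
  have hV := tendstoInDistribution_blockSums hκ hq hβ hc hY hYstar hlaw
  set m : Fin 3 → ℝ := fun x => blockFrac κ x * ((1 - β) * q) with hm
  have hmpos : ∀ x, 0 < m x := fun x =>
    mul_pos (blockFrac_pos hκ x) (mul_pos (sub_pos.2 hβ.2) hq.1)
  -- The set of block sums where the truncation of a denominator is active.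
  let C : Set (EuclideanSpace ℝ (Fin 3 ⊕ Fin 3)) := ⋃ x : Fin 3, {v | v (.inr x) ≤ m x / 2}
  have hC : IsClosed C := isClosed_iUnion_of_finite fun x =>
    isClosed_le (by fun_prop) continuous_const
  have hC0 : multivariateGaussian (limitMean κ q β) (limitCov κ q β) C = 0 := by
    refine measure_iUnion_null fun x => ?_
    refine measure_mono_null ?_ (ae_limit_apply_inr hκ hq hβ x)
    intro v hv hv'
    have hv1 : v (.inr x) ≤ m x / 2 := hv
    have hv2 : v (.inr x) = m x := hv'
    linarith [hmpos x]
  have hmeas : ∀ n, Measurable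
      (fun ω => blockSums (errRate n β γ₁ γ₂) (c n ω) (Y n ω) (Ystar n ω)) :=
    fun n => measurable_comp_model (hc n) (hY n) (hYstar n) _
  have hlim : Tendsto (fun n => (P n).real
      {ω | blockSums (errRate n β γ₁ γ₂) (c n ω) (Y n ω) (Ystar n ω) ∈ C}) atTop (𝓝 0) := by
    have h1 := ProbabilityMeasure.limsup_measure_closed_le_of_tendsto hV.tendsto hC
    simp only [ProbabilityMeasure.coe_mk, Measure.map_id, hC0] at h1
    have h2 : Tendsto (fun n => ((P n).map
        (fun ω => blockSums (errRate n β γ₁ γ₂) (c n ω) (Y n ω) (Ystar n ω))) C) atTop (𝓝 0) :=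
      tendsto_of_le_liminf_of_limsup_le zero_le h1
    have h3 := (ENNReal.tendsto_toReal ENNReal.zero_ne_top).comp h2
    refine h3.congr fun n => ?_
    simp only [Function.comp_apply]
    rw [Measure.map_apply (hmeas n) hC.measurableSet]
    rfl
  have hF := hV.continuous_comp (continuous_truncatedPivot hmpos)
  have hF' : TendstoInDistribution (fun n => truncatedPivot m ∘
      fun ω => blockSums (errRate n β γ₁ γ₂) (c n ω) (Y n ω) (Ystar n ω)) atTop
      id P (multivariateGaussian 0 (sigmaBeta κ q β)) := by
    refine ⟨hF.forall_aemeasurable, aemeasurable_id, ?_⟩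
    convert hF.tendsto using 2
    congr 1
    refine Subtype.ext ?_
    simp only [Measure.map_id, Function.comp_id]
    exact (map_truncatedPivot hκ hq hβ).symm
  -- At `n = 0` the pivot and the block sums are unrelated, so everything is exceptional there.
  refine tendstoInDistribution_of_tendsto_measure_ne hF'
    (fun n => (measurable_comp_model (hc n) (hY n) (hYstar n) _).aemeasurable)
    (B := fun n => if n = 0 then Set.univ else
      {ω | blockSums (errRate n β γ₁ γ₂) (c n ω) (Y n ω) (Ystar n ω) ∈ C})
    (fun n => ?_) (fun n ω hω => ?_) ?_
  · split_ifs
    · exact MeasurableSet.univ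
    · exact hmeas n hC.measurableSet
  · rcases Nat.eq_zero_or_pos n with hn | hn
    · simp [hn] at hω
    · rw [if_neg hn.ne'] at hω
      refine (pivot_eq_truncatedPivot hn hmpos _ _ _ fun x => ?_).symm
      by_contra hx
      exact hω (Set.mem_iUnion.2 ⟨x, not_lt.1 hx⟩)
  · refine hlim.congr' ?_
    filter_upwards [eventually_ne_atTop 0] with n hn
    rw [if_neg hn]

end Model

end NoisySBM


theorem mainTheorem5
    (κ q β μ₁ μ₂ γ₁ γ₂ : ℝ)
    (hκ : κ ∈ Set.Ioo (0 : ℝ) (1 / 2)) (hq : q ∈ Set.Ioo (0 : ℝ) 1) (hβ : β ∈ Set.Ioo (0 : ℝ) 1)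
    {Ω : ℕ → Type*} [∀ n, MeasurableSpace (Ω n)]
    (P : (n : ℕ) → Measure (Ω n)) [∀ n, IsProbabilityMeasure (P n)]
    (c : (n : ℕ) → Ω n → NoisySBM.Labels n)
    (A Y Ystar : (n : ℕ) → Ω n → NoisySBM.BinMat n)
    (hc : ∀ n, Measurable (c n)) (hA : ∀ n, Measurable (A n))
    (hY : ∀ n, Measurable (Y n)) (hYstar : ∀ n, Measurable (Ystar n))
    (hlaw : ∀ᶠ n in atTop,
      HasLaw (fun ω => (c n ω, A n ω, Y n ω, Ystar n ω))
        (NoisySBM.law n κ (NoisySBM.connMatrix n q μ₁ μ₂) (NoisySBM.errMatrix n β γ₁ γ₂)) (P n)) :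
    (NoisySBM.sigmaBeta κ q β).PosDef ∧
    TendstoInDistribution
      (fun n ω => NoisySBM.pivot β γ₁ γ₂ (c n ω) (Y n ω) (Ystar n ω)) atTop
      id P (multivariateGaussian 0 (NoisySBM.sigmaBeta κ q β)) ∧
    Tendsto (fun n => P n {ω | Y n ω ≠ Ystar n ω}) atTop (𝓝 1) ∧
    ∀ f : EuclideanSpace ℝ (Fin 3) →ᵇ ℝ,
      Tendsto
        (fun n => ∫ ω, f (NoisySBM.pivot β γ₁ γ₂ (c n ω) (Y n ω) (Ystar n ω))
          ∂(cond (P n) {ω | Y n ω ≠ Ystar n ω}))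
        atTop (𝓝 (∫ x, f x ∂(multivariateGaussian 0 (NoisySBM.sigmaBeta κ q β)))) := by
  have hκ' : κ ∈ Set.Ioo (0 : ℝ) 1 := ⟨hκ.1, hκ.2.trans (by norm_num)⟩
  have hpivot := NoisySBM.tendstoInDistribution_pivot hκ' hq hβ hc hY hYstar hlaw
  have hs : ∀ n, MeasurableSet {ω | Y n ω ≠ Ystar n ω} := fun n =>
    (measurableSet_eq_fun (hY n) (hYstar n)).compl
  have hne : Tendsto (fun n => (P n).real {ω | Y n ω ≠ Ystar n ω}ᶜ) atTop (𝓝 0) := by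
    refine (NoisySBM.tendsto_measureReal_replicates_eq hκ' hq hβ hY hYstar hlaw).congr fun n => ?_
    congr 1
    ext ω
    simp
  refine ⟨NoisySBM.posDef_sigmaBeta hκ' hq hβ, hpivot, ?_, fun f => ?_⟩
  · have h1 : Tendsto (fun n => ENNReal.ofReal ((P n).real {ω | Y n ω ≠ Ystar n ω})) atTop
        (𝓝 (ENNReal.ofReal 1)) := by
      refine (ENNReal.continuous_ofReal.tendsto _).comp ?_
      have := hne.const_sub 1
      rw [sub_zero] at this
      refine this.congr fun n => ?_
      rw [probReal_compl_eq_one_sub (hs n)]; ring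
    rw [ENNReal.ofReal_one] at h1
    exact h1.congr fun n => ofReal_measureReal
  · have hmeas : ∀ n, Measurable
        fun ω => NoisySBM.pivot β γ₁ γ₂ (c n ω) (Y n ω) (Ystar n ω) :=
      fun n => NoisySBM.measurable_comp_model (hc n) (hY n) (hYstar n) _
    refine NoisySBM.tendsto_integral_cond hmeas hs hne f ?_
    have := ProbabilityMeasure.tendsto_iff_forall_integral_tendsto.1 hpivot.tendsto f
    simp only [ProbabilityMeasure.coe_mk, Measure.map_id] at this
    refine this.congr fun n => ?_
    rw [integral_map (hmeas n).aemeasurable (by fun_prop)]
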